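/- Let $\mathfrak v=\mathbb R^m$ and $\mathfrak z=\mathbb R^r$ carry their standard euclidean inner products. For a linear map $j:\mathfrak z\to\mathfrak{so}(\mathfrak v)$, $Z\mapsto j_Z$, let $\mathfrak g(j)$ be the euclidean space $\mathfrak v\oplus\mathfrak z$ with the Lie bracket for which $\mathfrak z$ is central, $[\mathfrak v,\mathfrak v]\subseteq\mathfrak z$ and $\langle Z,[X,Y]\rangle=\langle j_ZX,Y\rangle$ for all $X,Y\in\mathfrak v$, $Z\in\mathfrak z$. Let $G(j)$ be the simply connected Lie group with Lie algebra $\mathfrak g(j)$, and $g(j)$ the left invariant Riemannian metric on $G(j)$ which is the given inner product on $T_eG(j)=\mathfrak g(j)$. The map $j$ is of Heisenberg type if $j_Z^2=-|Z|^2\,\mathrm{Id}_{\mathfrak v}$ for all $Z\in\mathfrak z$. A nilmanifold of Heisenberg type is a Riemannian manifold isometric to a quotient $(\Gamma\backslash G(j),g(j))$ by a discrete cocompact subgroup $\Gamma\subset G(j)$, with $j$ of Heisenberg type. Two such manifolds $N,N'$ are locally isometric if for all $p\in N$, $p'\in N'$ some isometry from a neighbourhood of $p$ onto a neighbourhood of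 $p'$ sends $p$ to $p'$. They are curvature equivalent if there are points $p\in N$, $p'\in N'$ and a linear isometry $F:T_pN\to T_{p'}N'$ such that $F(R(X,Y)Z)=R'(F(X),F(Y))F(Z)$ for all $X,Y,Z\in T_pN$, where $R$, $R'$ are the Riemannian curvature tensors. (Since these manifolds are locally homogeneous, the choice of points makes no difference in either definition.) Proposition. Let $N$ and $N'$ be nilmanifolds of Heisenberg type associated with $j:\mathbb R^r\to\mathfrak{so}(m)$ and $j':\mathbb R^{r'}\to\mathfrak{so}(m')$, for arbitrary $m,r,m',r'$. If $N$ and $N'$ are not locally isometric, then they are not curvature equivalent. Moreover, no linear isometry $F:\mathfrak g(j)\to\mathfrak g(j')$ of the associated metric Lie algebras satisfies $F(R(A,B)C)=R'(F(A),F(B))F(C)$ for all $A,B,C\in\mathfrak g(j)$, where $R$ and $R'$ are the curvature tensors of the left invariant metrics $g(j)$ and $g(j')$ at the neutral elements. -/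

import Mathlib

open scoped Manifold ContDiff

noncomputable section

namespace HeisenbergNil

/-! ### Two-step nilpotent metric Lie algebras and Lie groups -/

/-- The space `ℝⁿ` with its standard euclidean inner product. -/
abbrev Vec (n : ℕ) : Type := EuclideanSpace ℝ (Fin n)

/-- The Lie algebra `𝔰𝔬(ℝᵐ)` of skew-symmetric endomorphisms of `ℝᵐ`. -/
abbrev So (m : ℕ) : Submodule ℝ (Vec m →L[ℝ] Vec m) := skewAdjoint.submodule ℝ _

/-- The euclidean vector space `𝔤 = 𝔳 ⊕ 𝔷 = ℝᵐ ⊕ ℝʳ` (orthogonal direct sum). -/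
abbrev Alg (m r : ℕ) : Type := WithLp 2 (Vec m × Vec r)

variable {m r : ℕ}

/-- The component in `𝔷` of the bracket of two elements of `𝔳`; it is characterised by
`⟪Z, [X, Y]⟫ = ⟪j_Z X, Y⟫`, see `inner_bracketV`. -/
def bracketV (j : Vec r →ₗ[ℝ] So m) : Vec m →ₗ[ℝ] Vec m →ₗ[ℝ] Vec r :=
  LinearMap.mk₂ ℝ
    (fun X Y => WithLp.toLp 2 fun a =>
      inner ℝ ((j (EuclideanSpace.single a 1) : Vec m →L[ℝ] Vec m) X) Y)
    (fun X X' Y => by ext a; simp [inner_add_left])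
    (fun c X Y => by ext a; simp [inner_smul_left])
    (fun X Y Y' => by ext a; simp [inner_add_right])
    (fun c X Y => by ext a; simp [inner_smul_right])

theorem inner_bracketV (j : Vec r →ₗ[ℝ] So m) (X Y : Vec m) (Z : Vec r) :
    inner ℝ Z (bracketV j X Y) = inner ℝ ((j Z : Vec m →L[ℝ] Vec m) X) Y := by
  have hZ : Z = ∑ a, Z a • (EuclideanSpace.single a (1 : ℝ) : Vec r) := by
    ext b
    simp [Pi.single_apply]
  have h1 : (j Z : Vec m →L[ℝ] Vec m)
      = ∑ a, Z a • (j (EuclideanSpace.single a (1 : ℝ)) : Vec m →L[ℝ] Vec m) := by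
    conv_lhs => rw [hZ]
    simp [map_sum]
  rw [h1]
  simp [bracketV, PiLp.inner_apply, sum_inner, inner_smul_left, mul_comm]

theorem bracketV_self (j : Vec r →ₗ[ℝ] So m) (X : Vec m) : bracketV j X X = 0 := by
  refine ext_inner_left ℝ fun Z => ?_
  have h := (skewAdjoint.mem_iff.1 (j Z).2)
  have h2 := ContinuousLinearMap.adjoint_inner_left (j Z : Vec m →L[ℝ] Vec m) X X
  rw [← ContinuousLinearMap.star_eq_adjoint, h, neg_apply, inner_neg_left] at h2
  rw [inner_bracketV, inner_zero_right]
  have h3 := real_inner_comm X ((j Z : Vec m →L[ℝ] Vec m) X)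
  linarith

theorem alg_ext {a b : Alg m r} (h₁ : a.fst = b.fst) (h₂ : a.snd = b.snd) : a = b :=
  WithLp.ofLp_injective 2 (Prod.ext h₁ h₂)

/-- The Lie bracket of the two-step nilpotent Lie algebra `𝔤(j)`: `𝔷` is central and the bracket of
elements of `𝔳` is `bracketV j`. -/
def bracket (j : Vec r →ₗ[ℝ] So m) : Alg m r →ₗ[ℝ] Alg m r →ₗ[ℝ] Alg m r :=
  LinearMap.mk₂ ℝ (fun A B => WithLp.toLp 2 (0, bracketV j A.fst B.fst))
    (fun A A' B => by apply alg_ext <;> simp)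
    (fun c A B => by apply alg_ext <;> simp)
    (fun A B B' => by apply alg_ext <;> simp)
    (fun c A B => by apply alg_ext <;> simp)

/-- The Levi-Civita connection of the left invariant metric, on left invariant fields. It is the
solution of the Koszul formula
`2⟪∇_A B, C⟫ = ⟪[A, B], C⟫ - ⟪A, [B, C]⟫ - ⟪B, [A, C]⟫`. -/
def nablaAlg (j : Vec r →ₗ[ℝ] So m) (A B : Alg m r) : Alg m r :=
  (1 / 2 : ℝ) • (bracket j A B - LinearMap.adjoint (bracket j A) B
    - LinearMap.adjoint (bracket j B) A)

/-- The Riemannian curvature tensor of the metric Lie algebra `𝔤(j)`, with the sign convention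
`R(A, B) = ∇_{[A, B]} - [∇_A, ∇_B]`. -/
def curvatureAlg (j : Vec r →ₗ[ℝ] So m) (A B C : Alg m r) : Alg m r :=
  nablaAlg j (bracket j A B) C - (nablaAlg j A (nablaAlg j B C) - nablaAlg j B (nablaAlg j A C))

/-- `j` is of Heisenberg type: `j_Z ∘ j_Z = -|Z|² Id` for all `Z`. -/
def IsHeisenbergType (j : Vec r →ₗ[ℝ] So m) : Prop :=
  ∀ (Z : Vec r) (X : Vec m),
    (j Z : Vec m →L[ℝ] Vec m) ((j Z : Vec m →L[ℝ] Vec m) X) = -(‖Z‖ ^ 2) • X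

/-- The simply connected two-step nilpotent Lie group `G(j)` with Lie algebra `𝔤(j)`, in
exponential coordinates. -/
def Grp (_j : Vec r →ₗ[ℝ] So m) : Type := Alg m r

variable (j : Vec r →ₗ[ℝ] So m)

instance : TopologicalSpace (Grp j) := inferInstanceAs (TopologicalSpace (Alg m r))

instance : ChartedSpace (Alg m r) (Grp j) := inferInstanceAs (ChartedSpace (Alg m r) (Alg m r))

instance : IsManifold 𝓘(ℝ, Alg m r) ∞ (Grp j) :=
  inferInstanceAs (IsManifold 𝓘(ℝ, Alg m r) ∞ (Alg m r))

/-- The multiplication of `G(j)`, given by the Campbell-Baker-Hausdorff formula: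
`(X, Z) (Y, W) = (X + Y, Z + W + [X, Y] / 2)`. -/
def mulGrp (a b : Alg m r) : Alg m r := a + b + (1 / 2 : ℝ) • bracket j a b

theorem bracket_self (a : Alg m r) : bracket j a a = 0 := by
  apply alg_ext <;> simp [bracket, bracketV_self]

theorem bracket_bracket_left (a b c : Alg m r) : bracket j (bracket j a b) c = 0 := by
  apply alg_ext <;> simp [bracket]

theorem bracket_bracket_right (a b c : Alg m r) : bracket j a (bracket j b c) = 0 := by
  apply alg_ext <;> simp [bracket]

theorem mulGrp_assoc (a b c : Alg m r) :
    mulGrp j (mulGrp j a b) c = mulGrp j a (mulGrp j b c) := by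
  simp only [mulGrp, map_add, map_smul, LinearMap.add_apply, LinearMap.smul_apply,
    bracket_bracket_left, bracket_bracket_right]
  module

theorem zero_mulGrp (a : Alg m r) : mulGrp j 0 a = a := by
  simp [mulGrp]

theorem mulGrp_zero (a : Alg m r) : mulGrp j a 0 = a := by
  simp [mulGrp]

theorem neg_mulGrp (a : Alg m r) : mulGrp j (-a) a = 0 := by
  simp [mulGrp, bracket_self]

instance : Group (Grp j) where
  mul := mulGrp j
  one := (0 : Alg m r)
  inv := fun a : Alg m r => -a
  mul_assoc := mulGrp_assoc j
  one_mul := zero_mulGrp j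
  mul_one := mulGrp_zero j
  inv_mul_cancel := neg_mulGrp j

/-- The left invariant Riemannian metric `g(j)` on `G(j)` which is the standard euclidean inner
product on `T_e G(j) = 𝔤(j)`: tangent vectors at `a` are moved to the neutral element by the
differential of the left translation by `a⁻¹`. -/
def leftInvMetric (a : Grp j) (u v : TangentSpace 𝓘(ℝ, Alg m r) a) : ℝ :=
  let dL : TangentSpace 𝓘(ℝ, Alg m r) a →L[ℝ] Alg m r :=
    mfderiv 𝓘(ℝ, Alg m r) 𝓘(ℝ, Alg m r) (fun b : Grp j => a⁻¹ * b) a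
  inner ℝ (dL u) (dL v)

/-! ### Riemannian manifolds -/

section Manifolds

open scoped Bundle

variable (n n' : ℕ)
  (N : Type*) [TopologicalSpace N] [ChartedSpace (Vec n) N] [IsManifold (𝓡 n) ∞ N]
  [Bundle.RiemannianBundle (fun x : N => TangentSpace (𝓡 n) x)]
  [IsContMDiffRiemannianBundle (𝓡 n) ∞ (Vec n) (fun x : N => TangentSpace (𝓡 n) x)]
  (N' : Type*) [TopologicalSpace N'] [ChartedSpace (Vec n') N'] [IsManifold (𝓡 n') ∞ N']
  [Bundle.RiemannianBundle (fun x : N' => TangentSpace (𝓡 n') x)]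
  [IsContMDiffRiemannianBundle (𝓡 n') ∞ (Vec n') (fun x : N' => TangentSpace (𝓡 n') x)]

/-- The Riemannian manifold `N` is (isometric to) a Riemannian nilmanifold `(Γ \ G(j), g(j))`:
there are a discrete, cocompact subgroup `Γ` of `G(j)` and a surjective local diffeomorphism
`pr : G(j) → N` whose fibres are exactly the orbits of `Γ` acting by left translations (so that `N`
is the smooth quotient `Γ \ G(j)`), and the metric of `N` is the quotient metric. -/
structure IsNilmanifold : Prop where
  compactSpace : CompactSpace N
  exists_quotient : ∃ (Γ : Subgroup (Grp j)) (pr : Grp j → N),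
    DiscreteTopology Γ ∧ Function.Surjective pr ∧
    (∀ a b : Grp j, pr a = pr b ↔ ∃ γ ∈ Γ, b = γ * a) ∧
    IsLocalDiffeomorph 𝓘(ℝ, Alg m r) (𝓡 n) ∞ pr ∧
    ∀ (a : Grp j) (u v : TangentSpace 𝓘(ℝ, Alg m r) a),
      inner ℝ (mfderiv 𝓘(ℝ, Alg m r) (𝓡 n) pr a u) (mfderiv 𝓘(ℝ, Alg m r) (𝓡 n) pr a v)
        = leftInvMetric j a u v

/-- Local isometry of locally homogeneous Riemannian manifolds: for all points `p`, `p'` there is a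
Riemannian isometry from an open neighbourhood of `p` onto an open neighbourhood of `p'` which
sends `p` to `p'`. -/
def LocallyIsometric : Prop :=
  ∀ (p : N) (p' : N'), ∃ Φ : PartialDiffeomorph (𝓡 n) (𝓡 n') N N' ∞,
    p ∈ Φ.source ∧ Φ p = p' ∧
    ∀ q ∈ Φ.source, ∀ u v : TangentSpace (𝓡 n) q,
      inner ℝ (mfderiv (𝓡 n) (𝓡 n') Φ q u) (mfderiv (𝓡 n) (𝓡 n') Φ q v) = inner ℝ u v

variable {n n' N N'}

/-- `D` is the Levi-Civita connection of the Riemannian manifold `N`, i.e. the (unique) metric and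
torsion-free covariant derivative on `TN`; in Mathlib's notation `D Y x u` is `∇_u Y` for
`u ∈ T_x N`. -/
structure IsLeviCivita
    (D : CovariantDerivative (𝓡 n) (Vec n) (fun x : N => TangentSpace (𝓡 n) x)) : Prop where
  metric : ∀ (x : N) (Y Z : (y : N) → TangentSpace (𝓡 n) y),
    MDifferentiableAt (𝓡 n) (𝓡 n).tangent (fun y => (⟨y, Y y⟩ : TangentBundle (𝓡 n) N)) x →
    MDifferentiableAt (𝓡 n) (𝓡 n).tangent (fun y => (⟨y, Z y⟩ : TangentBundle (𝓡 n) N)) x →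
    ∀ u : TangentSpace (𝓡 n) x,
      (mfderiv (𝓡 n) 𝓘(ℝ, ℝ) (fun y => (inner ℝ (Y y) (Z y) : ℝ)) x u : ℝ)
        = inner ℝ (D Y x u) (Z x) + inner ℝ (Y x) (D Z x u)
  torsion_free : D.torsion = 0

/-- The curvature of `D` on vector fields,
`R(X, Y) Z = ∇_{[X, Y]} Z - (∇_X ∇_Y Z - ∇_Y ∇_X Z)`. -/
def curvatureField
    (D : CovariantDerivative (𝓡 n) (Vec n) (fun x : N => TangentSpace (𝓡 n) x))
    (X Y Z : (x : N) → TangentSpace (𝓡 n) x) (x : N) : TangentSpace (𝓡 n) x :=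
  D Z x (VectorField.mlieBracket (𝓡 n) X Y x)
    - (D (fun y => D Z y (Y y)) x (X x) - D (fun y => D Z y (X y)) x (Y x))

/-- The curvature tensor `R(u, v) w` of `D` at the point `p`, computed from smooth vector fields
near `p` with the values `u`, `v`, `w` at `p` (the result does not depend on their choice). -/
def curvature
    (D : CovariantDerivative (𝓡 n) (Vec n) (fun x : N => TangentSpace (𝓡 n) x))
    (p : N) (u v w : TangentSpace (𝓡 n) p) : TangentSpace (𝓡 n) p :=
  curvatureField D (FiberBundle.extend (Vec n) u) (FiberBundle.extend (Vec n) v)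
    (FiberBundle.extend (Vec n) w) p

/-- There is a euclidean isometry `F : T_p N → T_{p'} N'` which intertwines the Riemannian
curvature tensors, `F(R(u, v) w) = R'(F u, F v) F w`. -/
def CurvatureEquivalentAt (p : N) (p' : N') : Prop :=
  ∃ (D : CovariantDerivative (𝓡 n) (Vec n) (fun x : N => TangentSpace (𝓡 n) x))
    (D' : CovariantDerivative (𝓡 n') (Vec n') (fun x : N' => TangentSpace (𝓡 n') x)),
    IsLeviCivita D ∧ IsLeviCivita D' ∧
    ∃ F : TangentSpace (𝓡 n) p ≃ₗᵢ[ℝ] TangentSpace (𝓡 n') p',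
      ∀ u v w, F (curvature D p u v w) = curvature D' p' (F u) (F v) (F w)

variable (n n' N N')

/-- Curvature equivalence (of order zero) of locally homogeneous Riemannian manifolds; by local
homogeneity it does not matter at which points `p`, `p'` the curvature tensors are compared. -/
def CurvatureEquivalent : Prop :=
  ∃ (p : N) (p' : N'), CurvatureEquivalentAt (n := n) (n' := n') p p'

end Manifolds

end HeisenbergNil

end

open scoped Manifold ContDiff

noncomputable section

namespace HeisenbergNil

/-! ### Levi-Civita connection of the metric Lie algebra in closed form -/

section AlgebraicCurvature

variable {m r : ℕ} (j : Vec r →ₗ[ℝ] So m)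

/-! Both claims reduce to algebra: a linear isometry `F` between the metric Lie algebras which
preserves curvature can be replaced by an isometric Lie algebra isomorphism Φ, and Φ makes `N` and
`N'` locally isometric.

For Heisenberg type the Ricci form is −r/2 on 𝔳 and m/4 on 𝔷 (`ricciForm_eq`). If m, r > 0, the
signs separate 𝔳 from 𝔷, so F = S ⊕ T (`PreservesCurvature.exists_blocks`). If m = 0 or r = 0, both
algebras are abelian and Φ = F works.

In the block case, pull j' back to 𝔳 as k_Z = S⁻¹ j'_{TZ} S. The component R(X, Z)Y = [X, j_Z Y]/4
gives k_Z k_{Z'} = j_Z j_{Z'}, and R(X, Y)X = −(3/4) j_{[X,Y]}X gives k_Z X ∈ j_𝔷 X. The products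
alone would allow k = j on one submodule and k = −j on another; the second condition excludes such a
mixture. Accordingly, P = Id − k_e j_e with |e| = 1 intertwines j and k and is either injective or
zero. In the first case its polar part is an orthogonal intertwiner, in the second k = −j
(`exists_isometry_sign`). The sign ε is absorbed by Φ = SU ⊕ εT.

On the geometric side, x ↦ a'Φ(a⁻¹x) respects left invariant fields and descends through local
inverses of the quotient maps to local isometries (`locallyIsometric_of_bracket_isometry`).
Conversely, left invariant fields descend locally to orthonormal frames with constant structure
coefficients. The Koszul formula and the tensoriality of curvature then identify the curvature of
the manifold with `curvatureAlg` (`IsLieFrame.curvature_apply`), so a curvature equivalence yields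
such an F. -/

theorem inner_nablaAlg (A B C : Alg m r) :
    2 * inner ℝ (nablaAlg j A B) C = inner ℝ (bracket j A B) C - inner ℝ A (bracket j B C)
      - inner ℝ B (bracket j A C) := by
  unfold nablaAlg
  rw [real_inner_smul_left, inner_sub_left, inner_sub_left, LinearMap.adjoint_inner_left,
    LinearMap.adjoint_inner_left]
  ring

theorem inner_j_left (Z : Vec r) (X Y : Vec m) :
    inner ℝ ((j Z : Vec m →L[ℝ] Vec m) X) Y = - inner ℝ X ((j Z : Vec m →L[ℝ] Vec m) Y) := by
  have h := (skewAdjoint.mem_iff.1 (j Z).2)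
  have h2 := ContinuousLinearMap.adjoint_inner_left (j Z : Vec m →L[ℝ] Vec m) Y X
  rw [← ContinuousLinearMap.star_eq_adjoint, h, neg_apply, inner_neg_left] at h2
  linarith

@[simp] theorem bracket_fst (A B : Alg m r) : (bracket j A B).fst = 0 := rfl

@[simp] theorem bracket_snd (A B : Alg m r) : (bracket j A B).snd = bracketV j A.fst B.fst := rfl

theorem bracketV_swap (X Y : Vec m) : bracketV j X Y = - bracketV j Y X := by
  have h := bracketV_self j (X + Y)
  simp only [map_add, LinearMap.add_apply, bracketV_self] at h
  rw [zero_add, add_zero] at h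
  exact eq_neg_of_add_eq_zero_right h

theorem bracket_swap (A B : Alg m r) : bracket j A B = - bracket j B A := by
  have h := bracket_self j (A + B)
  simp only [map_add, LinearMap.add_apply, bracket_self] at h
  rw [zero_add, add_zero] at h
  exact eq_neg_of_add_eq_zero_right h

theorem inner_alg (A B : Alg m r) :
    (inner ℝ A B : ℝ) = inner ℝ A.fst B.fst + inner ℝ A.snd B.snd :=
  WithLp.prod_inner_apply A B

theorem nablaAlg_eq (A B : Alg m r) :
    nablaAlg j A B = WithLp.toLp 2
      (-(1 / 2 : ℝ) • ((j A.snd : Vec m →L[ℝ] Vec m) B.fst + (j B.snd : Vec m →L[ℝ] Vec m) A.fst),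
        (1 / 2 : ℝ) • bracketV j A.fst B.fst) := by
  refine ext_inner_right ℝ fun C => ?_
  have k := inner_nablaAlg j A B C
  simp only [inner_alg, bracket_fst, bracket_snd, inner_zero_right, inner_zero_left,
    zero_add, inner_bracketV] at k ⊢
  rw [real_inner_comm C.snd] at k ⊢
  simp only [WithLp.toLp_fst, WithLp.toLp_snd, inner_smul_left,
    inner_add_left, conj_trivial] at k ⊢
  have h1 := inner_j_left j C.snd A.fst B.fst
  have h2 := inner_j_left j C.snd B.fst A.fst
  linarith

theorem nablaAlg_fst (A B : Alg m r) : (nablaAlg j A B).fst =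
    -(1 / 2 : ℝ) • ((j A.snd : Vec m →L[ℝ] Vec m) B.fst + (j B.snd : Vec m →L[ℝ] Vec m) A.fst) := by
  rw [nablaAlg_eq]
  rfl

theorem nablaAlg_snd (A B : Alg m r) :
    (nablaAlg j A B).snd = (1 / 2 : ℝ) • bracketV j A.fst B.fst := by
  rw [nablaAlg_eq]
  rfl

/-- The connection as a bilinear map. -/
def nablaHom : Alg m r →ₗ[ℝ] Alg m r →ₗ[ℝ] Alg m r :=
  LinearMap.mk₂ ℝ (nablaAlg j)
    (fun A A' B => by
      apply alg_ext <;> simp [nablaAlg_fst, nablaAlg_snd]; module)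
    (fun c A B => by
      apply alg_ext <;> simp [nablaAlg_fst, nablaAlg_snd] <;> module)
    (fun A B B' => by
      apply alg_ext <;> simp [nablaAlg_fst, nablaAlg_snd]; module)
    (fun c A B => by
      apply alg_ext <;> simp [nablaAlg_fst, nablaAlg_snd] <;> module)

/-- The curvature tensor as an endomorphism in its third argument. -/
def curvatureHom (A B : Alg m r) : Alg m r →ₗ[ℝ] Alg m r :=
  nablaHom j (bracket j A B) - (nablaHom j A ∘ₗ nablaHom j B - nablaHom j B ∘ₗ nablaHom j A)

@[simp] theorem curvatureHom_apply (A B C : Alg m r) :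
    curvatureHom j A B C = curvatureAlg j A B C := rfl

end AlgebraicCurvature

/-! ### Orthogonal intertwiners of Clifford module structures -/

section Intertwiners

variable {V ι : Type*} [NormedAddCommGroup V] [InnerProductSpace ℝ V] [FiniteDimensional ℝ V]

/-- If an injective `P` intertwines two families of skew maps, so does an orthogonal map: the
orthogonal part in the polar decomposition of `P`. -/
theorem exists_isometry_intertwiner {P : V →ₗ[ℝ] V} (hP : Function.Injective P)
    {j k : ι → V →ₗ[ℝ] V} (hj : ∀ Z X Y, inner ℝ (j Z X) Y = - inner ℝ X (j Z Y))
    (hk : ∀ Z X Y, inner ℝ (k Z X) Y = - inner ℝ X (k Z Y))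
    (hP' : ∀ Z X, k Z (P X) = P (j Z X)) :
    ∃ S : V ≃ₗᵢ[ℝ] V, ∀ Z X, k Z (S X) = S (j Z X) := by
  have hQ : (LinearMap.adjoint P ∘ₗ P).IsSymmetric := fun x y => by
    simp only [LinearMap.comp_apply, LinearMap.adjoint_inner_left, LinearMap.adjoint_inner_right]
  set b := hQ.eigenvectorBasis rfl with hb
  set l := hQ.eigenvalues rfl with hl
  have hbl : ∀ i X, inner ℝ (P X) (P (b i)) = l i * (inner ℝ X (b i) : ℝ) := by
    intro i X
    have h := hQ.apply_eigenvectorBasis rfl i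
    rw [← LinearMap.adjoint_inner_right, ← LinearMap.comp_apply, h, inner_smul_right]
    rfl
  have hpos : ∀ i, 0 < l i := by
    intro i
    have h := hbl i (b i)
    rw [real_inner_self_eq_norm_sq, real_inner_self_eq_norm_sq, b.norm_eq_one, one_pow,
      mul_one] at h
    rw [← h]
    have : P (b i) ≠ 0 := fun h0 => b.orthonormal.ne_zero i (hP (h0.trans (map_zero P).symm))
    positivity
  -- S = P (P*P)^(-1/2), written in an orthonormal eigenbasis of P*P with eigenvalues `l i` > 0.
  let S : V →ₗ[ℝ] V := b.toBasis.constr ℝ fun i => (√(l i))⁻¹ • P (b i)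
  have hS : ∀ i, S (b i) = (√(l i))⁻¹ • P (b i) := by
    intro i
    have := b.toBasis.constr_basis ℝ (fun i => (√(l i))⁻¹ • P (b i)) i
    rwa [b.coe_toBasis] at this
  have hort : Orthonormal ℝ (S ∘ b.toBasis) := by
    classical
    rw [orthonormal_iff_ite]
    intro i i'
    simp only [Function.comp_apply, b.coe_toBasis, hS, inner_smul_left, inner_smul_right, hbl,
      conj_trivial, orthonormal_iff_ite.1 b.orthonormal]
    split_ifs with h
    · subst h
      have := Real.mul_self_sqrt (hpos i).le
      have h' : √(l i) ≠ 0 := (Real.sqrt_pos.2 (hpos i)).ne'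
      field_simp
      linarith
    · simp
  have hS' : ∀ Z X, k Z (S X) = S (j Z X) := by
    intro Z X
    have : k Z ∘ₗ S = S ∘ₗ j Z := by
      refine b.toBasis.ext fun i => ?_
      simp only [LinearMap.comp_apply, b.coe_toBasis, hS, map_smul, hP']
      conv_rhs => rw [← b.sum_repr' (j Z (b i))]
      conv_lhs => rw [← b.sum_repr' (j Z (b i))]
      simp only [map_sum, map_smul, Finset.smul_sum, hS]
      refine Finset.sum_congr rfl fun i' _ => ?_
      rw [smul_comm]
      -- P*P commutes with j_Z, so a nonzero matrix coefficient of j_Z between b_i and b_{i'} forces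
      -- l_i = l_{i'}; the two normalising factors then agree.
      by_cases h0 : (inner ℝ (b i') (j Z (b i)) : ℝ) = 0
      · simp [h0]
      · have h1 := hbl i' (j Z (b i))
        have h2 := hbl i (j Z (b i'))
        rw [← hP', hk, hP', real_inner_comm, h2, hj Z (b i'), real_inner_comm] at h1
        rw [real_inner_comm (b i') (j Z (b i))] at h1
        have h3 : l i = l i' := mul_right_cancel₀ h0 (by linarith)
        rw [h3]
    exact LinearMap.congr_fun this X
  have hb' : Orthonormal ℝ b.toBasis := by
    rw [b.coe_toBasis]
    exact b.orthonormal
  exact ⟨(S.isometryOfOrthonormal hb' hort).toLinearIsometryEquiv rfl, hS'⟩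

variable {W : Type*} [NormedAddCommGroup W] [NormedSpace ℝ W]

/-- Two Clifford module structures `j`, `k` with `k_Z k_{Z'} = j_Z j_{Z'}` and `k_Z X ∈ j_W X` are
equivalent up to the sign. -/
theorem exists_isometry_sign {j : W →ₗ[ℝ] V →ₗ[ℝ] V} {k : W → V →ₗ[ℝ] V}
    (hj : ∀ Z X Y, inner ℝ (j Z X) Y = - inner ℝ X (j Z Y))
    (hk : ∀ Z X Y, inner ℝ (k Z X) Y = - inner ℝ X (k Z Y))
    (hj2 : ∀ Z X, j Z (j Z X) = -(‖Z‖ ^ 2) • X)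
    (hjk : ∀ Z Z' X, k Z (k Z' X) = j Z (j Z' X))
    (hex : ∀ Z X, ∃ Z', k Z X = j Z' X) {e : W} (he : ‖e‖ = 1) :
    ∃ (S : V ≃ₗᵢ[ℝ] V) (ε : ℝ), ε * ε = 1 ∧ ∀ Z X, k Z (S X) = ε • S (j Z X) := by
  have hje : ∀ X, j e (j e X) = - X := fun X => by simp [hj2, he]
  have hke : ∀ X, k e (k e X) = - X := fun X => by rw [hjk, hje]
  -- Both k_Z P and P j_Z equal k_Z + j_Z, so P intertwines; its kernel is the part of V where k =
  -- −j.
  let P : V →ₗ[ℝ] V := LinearMap.id - k e ∘ₗ j e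
  have hP : ∀ X, P X = X - k e (j e X) := fun X => rfl
  have hkP : ∀ Z X, k Z (P X) = k Z X + j Z X := fun Z X => by
    rw [hP, map_sub, hjk, hje, map_neg, sub_neg_eq_add]
  have hPj : ∀ Z X, P (j Z X) = k Z X + j Z X := fun Z X => by
    rw [hP, ← hjk, hke, sub_neg_eq_add, add_comm]
  have hker : ∀ X, P X = 0 ↔ k e X + j e X = 0 := fun X => by
    rw [← hkP]
    refine ⟨fun h => by rw [h, map_zero], fun h => ?_⟩
    have := hke (P X)
    rw [h, map_zero] at this
    exact neg_eq_zero.1 this.symm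
  have hkerk : ∀ X, P X = 0 → ∀ Z, k Z X = - j Z X := fun X h Z => by
    have := hkP Z X
    rw [h, map_zero] at this
    exact eq_neg_of_add_eq_zero_left this.symm
  have hkerj : ∀ X, P X = 0 → ∀ Z, P (j Z X) = 0 := fun X h Z => by
    rw [hPj, ← hkP, h, map_zero]
  by_cases hinj : Function.Injective P
  · obtain ⟨S, hS⟩ := exists_isometry_intertwiner hinj (j := fun Z => j Z) hj hk
      (fun Z X => (hkP Z X).trans (hPj Z X).symm)
    exact ⟨S, 1, one_mul 1, fun Z X => by rw [hS, one_smul]⟩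
  · obtain ⟨X, hX, hX0⟩ : ∃ X, P X = 0 ∧ X ≠ 0 := by
      by_contra! h
      exact hinj ((injective_iff_map_eq_zero P).2 h)
    have hperp : (LinearMap.ker P)ᗮ = ⊥ := by
      rw [Submodule.eq_bot_iff]
      intro Y hY
      have hjY : ∀ Z, j Z Y ∈ (LinearMap.ker P)ᗮ := fun Z => by
        rw [Submodule.mem_orthogonal']
        intro U hU
        rw [hj, (Submodule.mem_orthogonal' _ _).1 hY _ (hkerj U hU Z), neg_zero]
      have hkY : k e Y ∈ (LinearMap.ker P)ᗮ := by
        rw [Submodule.mem_orthogonal']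
        intro U hU
        rw [hk, hkerk U hU, inner_neg_right,
          (Submodule.mem_orthogonal' _ _).1 hY _ (hkerj U hU e), neg_zero, neg_zero]
      -- Mixing X in the kernel with Y orthogonal to it: k_e(X + Y) = j_Z(X + Y) splits along ker P
      -- and its complement. The kernel part forces Z = −e, and the other part then gives k_e Y =
      -- −j_e Y, so Y also lies in the kernel and vanishes.
      obtain ⟨Z, hZ⟩ := hex e (X + Y)
      rw [map_add, map_add, hkerk X hX] at hZ
      have h1 : - j e X - j Z X = j Z Y - k e Y := by
        rw [sub_eq_sub_iff_add_eq_add, hZ]; abel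
      have h2 : - j e X - j Z X = 0 := by
        refine (Submodule.disjoint_def.1 (Submodule.orthogonal_disjoint (LinearMap.ker P))) _ ?_ ?_
        · exact Submodule.sub_mem _ (Submodule.neg_mem _ (hkerj X hX e)) (hkerj X hX Z)
        · rw [h1]
          exact Submodule.sub_mem _ (hjY Z) hkY
      have h3 : j (e + Z) X = 0 := by
        rw [map_add, LinearMap.add_apply, ← neg_eq_zero, ← h2]; abel
      have h4 : e + Z = 0 := by
        have := hj2 (e + Z) X
        rw [h3, map_zero] at this
        simpa [hX0] using this.symm
      have h5 : Z = - e := (neg_eq_of_add_eq_zero_right h4).symm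
      rw [h2, eq_comm, sub_eq_zero, h5, map_neg, LinearMap.neg_apply] at h1
      have h6 : Y ∈ LinearMap.ker P := (hker Y).2 (by rw [← h1, neg_add_cancel])
      exact Submodule.disjoint_def.1 (Submodule.orthogonal_disjoint (LinearMap.ker P)) Y h6 hY
    have htop : LinearMap.ker P = ⊤ := by
      rwa [Submodule.orthogonal_eq_bot_iff] at hperp
    refine ⟨LinearIsometryEquiv.refl ℝ V, -1, by norm_num, fun Z X => ?_⟩
    have hX : X ∈ LinearMap.ker P := htop ▸ Submodule.mem_top
    simpa using hkerk X hX Z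

end Intertwiners

/-! ### Curvature components and Ricci form for Heisenberg type -/

section RicciForm

variable {m r m' r' : ℕ} (j : Vec r →ₗ[ℝ] So m) {j' : Vec r' →ₗ[ℝ] So m'}

/-- `B ↦ R(A, B) C` as a linear map. -/
def curvatureMiddle (A C : Alg m r) : Alg m r →ₗ[ℝ] Alg m r :=
  (nablaHom j).flip C ∘ₗ bracket j A
    - (nablaHom j A ∘ₗ (nablaHom j).flip C - (nablaHom j).flip (nablaAlg j A C))

theorem curvatureMiddle_apply (A B C : Alg m r) :
    curvatureMiddle j A C B = curvatureAlg j A B C := rfl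

/-- The Ricci form of `𝔤(j)`. -/
def ricciForm (A C : Alg m r) : ℝ := LinearMap.trace ℝ (Alg m r) (curvatureMiddle j A C)

variable {j} in
theorem ricciForm_map {F : Alg m r ≃ₗᵢ[ℝ] Alg m' r'}
    (hF : ∀ A B C, F (curvatureAlg j A B C) = curvatureAlg j' (F A) (F B) (F C)) (A C : Alg m r) :
    ricciForm j' (F A) (F C) = ricciForm j A C := by
  have h : curvatureMiddle j' (F A) (F C) =
      F.toLinearEquiv.conj (curvatureMiddle j A C) := by
    ext1 B
    obtain ⟨B, rfl⟩ := F.surjective B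
    rw [curvatureMiddle_apply, ← hF, ← curvatureMiddle_apply]
    simp [LinearEquiv.conj_apply]
  rw [ricciForm, h, LinearMap.trace_conj', ricciForm]

variable {j}

/-- Polarisation in Z of |j_Z X|² = |Z|²|X|². -/
theorem inner_j_j (hj : IsHeisenbergType j) (Z Z' : Vec r) (X : Vec m) :
    (inner ℝ ((j Z : Vec m →L[ℝ] Vec m) X) ((j Z' : Vec m →L[ℝ] Vec m) X) : ℝ) =
      inner ℝ Z Z' * ‖X‖ ^ 2 := by
  have hs : ∀ Z, (inner ℝ ((j Z : Vec m →L[ℝ] Vec m) X) ((j Z : Vec m →L[ℝ] Vec m) X) : ℝ) =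
      inner ℝ Z Z * ‖X‖ ^ 2 := fun Z => by
    rw [inner_j_left, hj, inner_smul_right, real_inner_self_eq_norm_sq, real_inner_self_eq_norm_sq]
    ring
  have h := hs (Z + Z')
  simp only [map_add, Submodule.coe_add, add_apply, inner_add_left, inner_add_right, hs] at h
  rw [real_inner_comm ((j Z : Vec m →L[ℝ] Vec m) X), real_inner_comm Z Z'] at h
  linarith

theorem inner_j_j_left (hj : IsHeisenbergType j) (Z : Vec r) (X Y : Vec m) :
    (inner ℝ ((j Z : Vec m →L[ℝ] Vec m) X) ((j Z : Vec m →L[ℝ] Vec m) Y) : ℝ) =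
      ‖Z‖ ^ 2 * inner ℝ X Y := by
  rw [inner_j_left, hj, inner_smul_right]
  ring

theorem curvatureAlg_fst (A B C : Alg m r) : (curvatureAlg j A B C).fst =
    -(1 / 2 : ℝ) • (j (bracketV j A.fst B.fst) : Vec m →L[ℝ] Vec m) C.fst
      + (1 / 2 : ℝ) • ((j A.snd : Vec m →L[ℝ] Vec m) (nablaAlg j B C).fst
        + (1 / 2 : ℝ) • (j (bracketV j B.fst C.fst) : Vec m →L[ℝ] Vec m) A.fst)
      - (1 / 2 : ℝ) • ((j B.snd : Vec m →L[ℝ] Vec m) (nablaAlg j A C).fst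
        + (1 / 2 : ℝ) • (j (bracketV j A.fst C.fst) : Vec m →L[ℝ] Vec m) B.fst) := by
  rw [curvatureAlg, WithLp.sub_fst, WithLp.sub_fst, nablaAlg_fst j (bracket j A B),
    nablaAlg_fst j A (nablaAlg j B C), nablaAlg_fst j B (nablaAlg j A C), nablaAlg_snd, nablaAlg_snd,
    bracket_fst, bracket_snd]
  simp only [map_zero, add_zero, map_smul, SetLike.val_smul, smul_apply]
  module

theorem curvatureAlg_snd (A B C : Alg m r) : (curvatureAlg j A B C).snd =
    (1 / 2 : ℝ) • bracketV j B.fst (nablaAlg j A C).fst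
      - (1 / 2 : ℝ) • bracketV j A.fst (nablaAlg j B C).fst := by
  rw [curvatureAlg, WithLp.sub_snd, WithLp.sub_snd, nablaAlg_snd, nablaAlg_snd j A, nablaAlg_snd j B,
    bracket_fst]
  simp only [map_zero, LinearMap.zero_apply, smul_zero]
  module

theorem inner_curvatureAlg_fst (A C : Alg m r) (Y : Vec m) :
    (inner ℝ (curvatureAlg j A (WithLp.toLp 2 (Y, 0)) C) (WithLp.toLp 2 (Y, 0)) : ℝ) =
      -(3 / 4) * inner ℝ (bracketV j A.fst Y) (bracketV j C.fst Y)
        + 1 / 4 * inner ℝ ((j A.snd : Vec m →L[ℝ] Vec m) Y) ((j C.snd : Vec m →L[ℝ] Vec m) Y) := by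
  rw [inner_alg, curvatureAlg_fst, nablaAlg_fst]
  simp only [WithLp.toLp_fst, WithLp.toLp_snd, map_zero, ZeroMemClass.coe_zero, zero_apply,
    zero_add, inner_zero_right, add_zero, inner_sub_left, inner_add_left, inner_smul_left,
    map_smul, conj_trivial, ← inner_bracketV, bracketV_self, mul_zero, sub_zero]
  rw [bracketV_swap j Y C.fst, inner_neg_left, inner_bracketV j _ Y A.snd,
    inner_j_left j A.snd, real_inner_comm ((j A.snd : Vec m →L[ℝ] Vec m) Y),
    real_inner_comm (bracketV j A.fst Y), inner_bracketV j Y _ A.snd]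
  ring

theorem inner_curvatureAlg_snd (hj : IsHeisenbergType j) (A C : Alg m r) (W : Vec r) :
    (inner ℝ (curvatureAlg j A (WithLp.toLp 2 (0, W)) C) (WithLp.toLp 2 (0, W)) : ℝ) =
      1 / 4 * (‖W‖ ^ 2 * inner ℝ A.fst C.fst) := by
  rw [inner_alg, curvatureAlg_snd, nablaAlg_fst j (WithLp.toLp 2 (0, W))]
  simp only [WithLp.toLp_fst, WithLp.toLp_snd, map_zero, LinearMap.zero_apply, smul_zero,
    zero_add, inner_zero_right, add_zero, inner_neg_left, inner_smul_left, zero_sub, map_smul,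
    conj_trivial]
  rw [real_inner_comm W, inner_bracketV, inner_j_j_left hj]
  ring

/-- Paired with elements of 𝔷, this component recovers the products j_Z j_{Z'}. -/
theorem curvatureAlg_fst_snd_fst (X Y : Vec m) (Z : Vec r) :
    curvatureAlg j (WithLp.toLp 2 (X, 0)) (WithLp.toLp 2 (0, Z)) (WithLp.toLp 2 (Y, 0)) =
      WithLp.toLp 2 (0, (1 / 4 : ℝ) • bracketV j X ((j Z : Vec m →L[ℝ] Vec m) Y)) := by
  apply alg_ext
  · simp [curvatureAlg_fst, nablaAlg_fst]
  · simp [curvatureAlg_snd, nablaAlg_fst]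
    module

/-- This component detects whether a vector lies in j_𝔷 X: for Y = j_Z X one has [X, Y] = |X|² Z. -/
theorem curvatureAlg_fst_fst_fst (X Y : Vec m) :
    curvatureAlg j (WithLp.toLp 2 (X, 0)) (WithLp.toLp 2 (Y, 0)) (WithLp.toLp 2 (X, 0)) =
      WithLp.toLp 2 (-(3 / 4 : ℝ) • (j (bracketV j X Y) : Vec m →L[ℝ] Vec m) X, 0) := by
  apply alg_ext
  · simp [curvatureAlg_fst, nablaAlg_fst, bracketV_swap j Y X, bracketV_self]
    module
  · simp [curvatureAlg_snd, nablaAlg_fst]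

/-- Parseval in 𝔷 and then in 𝔳 turns the sum into Σ_a ⟨j_a X, j_a X'⟩, and each of the r terms is
⟨X, X'⟩. -/
theorem sum_inner_bracketV (hj : IsHeisenbergType j) (X X' : Vec m) :
    ∑ i, (inner ℝ (bracketV j X (EuclideanSpace.basisFun (Fin m) ℝ i))
      (bracketV j X' (EuclideanSpace.basisFun (Fin m) ℝ i)) : ℝ) = r * inner ℝ X X' := by
  set b := EuclideanSpace.basisFun (Fin m) ℝ
  set c := EuclideanSpace.basisFun (Fin r) ℝ
  have h : ∀ i, (inner ℝ (bracketV j X (b i)) (bracketV j X' (b i)) : ℝ) =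
      ∑ a, inner ℝ ((j (c a) : Vec m →L[ℝ] Vec m) X) (b i) *
        inner ℝ (b i) ((j (c a) : Vec m →L[ℝ] Vec m) X') := by
    intro i
    rw [← c.sum_inner_mul_inner]
    refine Finset.sum_congr rfl fun a _ => ?_
    rw [real_inner_comm (c a) (bracketV j X (b i)), inner_bracketV, inner_bracketV,
      real_inner_comm (b i) ((j (c a) : Vec m →L[ℝ] Vec m) X')]
  simp only [h]
  rw [Finset.sum_comm]
  simp only [b.sum_inner_mul_inner, inner_j_j_left hj, c.norm_eq_one]
  simp

/-- The trace over 𝔳 contributes −3r/4 on 𝔳 and m/4 on 𝔷; the trace over 𝔷 contributes r/4 on 𝔳. -/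
theorem ricciForm_eq (hj : IsHeisenbergType j) (A C : Alg m r) :
    ricciForm j A C = -(r / 2) * inner ℝ A.fst C.fst + m / 4 * inner ℝ A.snd C.snd := by
  set b := EuclideanSpace.basisFun (Fin m) ℝ with hb
  set c := EuclideanSpace.basisFun (Fin r) ℝ with hc
  rw [ricciForm, LinearMap.trace_eq_sum_inner _ (b.prod c), Fintype.sum_sum_type]
  have h1 : ∀ i, (b.prod c) (Sum.inl i) = WithLp.toLp 2 (b i, 0) := fun i => by simp
  have h2 : ∀ i, (b.prod c) (Sum.inr i) = WithLp.toLp 2 (0, c i) := fun i => by simp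
  simp only [h1, h2, curvatureMiddle_apply]
  have h3 : ∀ i, (inner ℝ (WithLp.toLp 2 (b i, 0) : Alg m r)
      (curvatureAlg j A (WithLp.toLp 2 (b i, 0)) C) : ℝ) = _ := fun i =>
    (real_inner_comm _ _).trans (inner_curvatureAlg_fst A C (b i))
  have h4 : ∀ i, (inner ℝ (WithLp.toLp 2 (0, c i) : Alg m r)
      (curvatureAlg j A (WithLp.toLp 2 (0, c i)) C) : ℝ) = _ := fun i =>
    (real_inner_comm _ _).trans (inner_curvatureAlg_snd hj A C (c i))
  simp only [h3, h4, Finset.sum_add_distrib, ← Finset.mul_sum, inner_j_j hj, b.norm_eq_one,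
    c.norm_eq_one]
  rw [sum_inner_bracketV hj]
  simp
  ring

end RicciForm

/-! ### From curvature preserving isometries to Lie algebra isomorphisms -/

section CurvatureIsometries

variable {m r m' r' : ℕ} {j : Vec r →ₗ[ℝ] So m} {j' : Vec r' →ₗ[ℝ] So m'}

/-- `F` intertwines the curvature tensors of `𝔤(j)` and `𝔤(j')`. -/
def PreservesCurvature (j : Vec r →ₗ[ℝ] So m) (j' : Vec r' →ₗ[ℝ] So m')
    (F : Alg m r ≃ₗᵢ[ℝ] Alg m' r') : Prop :=
  ∀ A B C : Alg m r, F (curvatureAlg j A B C) = curvatureAlg j' (F A) (F B) (F C)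

variable {F : Alg m r ≃ₗᵢ[ℝ] Alg m' r'}

theorem PreservesCurvature.symm (hF : PreservesCurvature j j' F) :
    PreservesCurvature j' j F.symm := fun A B C => by
  rw [F.symm_apply_eq, hF]
  simp only [F.apply_symm_apply]

theorem ricciForm_eq_zero (hj : IsHeisenbergType j) (h : m = 0 ∨ r = 0) (A C : Alg m r) :
    ricciForm j A C = 0 := by
  rw [ricciForm_eq hj]
  rcases h with rfl | rfl
  · simp [Subsingleton.elim A.fst 0]
  · simp [Subsingleton.elim A.snd 0]

/-- Ricci flatness detects the abelian case, so `F` cannot relate an abelian algebra to a nonabelian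
one. -/
theorem eq_zero_of_ricciForm_eq_zero (hj : IsHeisenbergType j)
    (h : ∀ A, ricciForm j A A = 0) : m = 0 ∨ r = 0 := by
  by_contra! h0
  obtain ⟨i⟩ : Nonempty (Fin m) := Fin.pos_iff_nonempty.1 (Nat.pos_of_ne_zero h0.1)
  have := h (WithLp.toLp 2 (EuclideanSpace.single i 1, 0))
  rw [ricciForm_eq hj] at this
  simp [h0.2] at this

theorem bracket_eq_zero (h : m = 0 ∨ r = 0) (A B : Alg m r) : bracket j A B = 0 := by
  apply alg_ext
  · rfl
  · rw [bracket_snd]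
    rcases h with rfl | rfl
    · simp [Subsingleton.elim A.fst 0]
    · exact Subsingleton.elim _ _

theorem PreservesCurvature.degenerate_iff (hF : PreservesCurvature j j' F)
    (hj : IsHeisenbergType j) (hj' : IsHeisenbergType j') (h : m = 0 ∨ r = 0) : m' = 0 ∨ r' = 0 := by
  refine eq_zero_of_ricciForm_eq_zero hj' fun A => ?_
  rw [← ricciForm_map hF.symm, ricciForm_eq_zero hj h]

theorem PreservesCurvature.ricci (hF : PreservesCurvature j j' F)
    (hj : IsHeisenbergType j) (hj' : IsHeisenbergType j') (A C : Alg m r) :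
    -(r' / 2) * inner ℝ (F A).fst (F C).fst + m' / 4 * inner ℝ (F A).snd (F C).snd =
      -(r / 2) * inner ℝ A.fst C.fst + m / 4 * (inner ℝ A.snd C.snd : ℝ) := by
  rw [← ricciForm_eq hj, ← ricciForm_eq hj', ricciForm_map hF]

/-- Let X be the 𝔳'-component of F(0, Z). Pairing F(0, Z) with (X, 0) in the inner product and in
the Ricci form gives −(r'/2)|X|² = (m/4)|X|², so X = 0 because m > 0. No relation between the
dimensions of the two algebras is needed beforehand. -/
theorem PreservesCurvature.map_snd_fst (hF : PreservesCurvature j j' F)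
    (hj : IsHeisenbergType j) (hj' : IsHeisenbergType j') (hm : 0 < m) (Z : Vec r) :
    (F (WithLp.toLp 2 (0, Z))).fst = 0 := by
  set A : Alg m r := WithLp.toLp 2 (0, Z) with hA
  set X := (F A).fst with hX
  obtain ⟨C, hC⟩ := F.surjective (WithLp.toLp 2 (X, 0))
  have h := hF.ricci hj hj' A C
  have h' := F.inner_map_map A C
  rw [inner_alg, inner_alg A C] at h'
  have hm' : (0 : ℝ) < m := by exact_mod_cast hm
  simp only [hC, hA, WithLp.toLp_fst, WithLp.toLp_snd,
    inner_zero_left, inner_zero_right, mul_zero, zero_add, add_zero] at h h'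
  simp only [← hA, ← hX, ← h'] at h
  have hr : (0 : ℝ) ≤ r' := Nat.cast_nonneg _
  have h2 : (m / 4 + r' / 2 : ℝ) * inner ℝ X X = 0 := by linarith
  rcases mul_eq_zero.1 h2 with h3 | h3
  · linarith
  · exact inner_self_eq_zero.1 h3

theorem PreservesCurvature.map_fst_snd (hF : PreservesCurvature j j' F)
    (hj : IsHeisenbergType j) (hj' : IsHeisenbergType j') (hr : 0 < r) (Y : Vec m) :
    (F (WithLp.toLp 2 (Y, 0))).snd = 0 := by
  set A : Alg m r := WithLp.toLp 2 (Y, 0) with hA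
  set X := (F A).snd with hX
  obtain ⟨C, hC⟩ := F.surjective (WithLp.toLp 2 (0, X))
  have h := hF.ricci hj hj' A C
  have h' := F.inner_map_map A C
  rw [inner_alg, inner_alg A C] at h'
  have hr' : (0 : ℝ) < r := by exact_mod_cast hr
  simp only [hC, hA, WithLp.toLp_fst, WithLp.toLp_snd,
    inner_zero_left, inner_zero_right, mul_zero, zero_add, add_zero] at h h'
  simp only [← hA, ← hX, ← h'] at h
  have hm : (0 : ℝ) ≤ m' := Nat.cast_nonneg _
  have h2 : (r / 2 + m' / 4 : ℝ) * inner ℝ X X = 0 := by linarith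
  rcases mul_eq_zero.1 h2 with h3 | h3
  · linarith
  · exact inner_self_eq_zero.1 h3

/-- Away from the abelian case a curvature preserving isometry is block diagonal. -/
theorem PreservesCurvature.exists_blocks (hF : PreservesCurvature j j' F)
    (hj : IsHeisenbergType j) (hj' : IsHeisenbergType j') (hm : 0 < m) (hr : 0 < r)
    (hm' : 0 < m') (hr' : 0 < r') :
    ∃ (S : Vec m ≃ₗᵢ[ℝ] Vec m') (T : Vec r ≃ₗᵢ[ℝ] Vec r'),
      (∀ X, F (WithLp.toLp 2 (X, 0)) = WithLp.toLp 2 (S X, 0)) ∧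
      ∀ Z, F (WithLp.toLp 2 (0, Z)) = WithLp.toLp 2 (0, T Z) := by
  have h1 := hF.map_fst_snd hj hj' hr
  have h2 := hF.map_snd_fst hj hj' hm
  have h1' := hF.symm.map_fst_snd hj' hj hr'
  have h2' := hF.symm.map_snd_fst hj' hj hm'
  let S : Vec m →ₗᵢ[ℝ] Vec m' :=
    { toFun := fun X => (F (WithLp.toLp 2 (X, 0))).fst
      map_add' := fun X Y => by
        rw [← WithLp.add_fst, ← map_add]; congr 2; apply alg_ext <;> simp
      map_smul' := fun c X => by
        rw [RingHom.id_apply, ← WithLp.smul_fst, ← map_smul]; congr 2; apply alg_ext <;> simp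
      norm_map' := fun X => by
        have h : F (WithLp.toLp 2 (X, 0)) = WithLp.toLp 2 ((F (WithLp.toLp 2 (X, 0))).fst, 0) :=
          alg_ext rfl (h1 X)
        have h' := F.norm_map (WithLp.toLp 2 (X, 0))
        rw [h] at h'
        simpa using h' }
  let T : Vec r →ₗᵢ[ℝ] Vec r' :=
    { toFun := fun Z => (F (WithLp.toLp 2 (0, Z))).snd
      map_add' := fun X Y => by
        rw [← WithLp.add_snd, ← map_add]; congr 2; apply alg_ext <;> simp
      map_smul' := fun c X => by
        rw [RingHom.id_apply, ← WithLp.smul_snd, ← map_smul]; congr 2; apply alg_ext <;> simp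
      norm_map' := fun X => by
        have h : F (WithLp.toLp 2 (0, X)) = WithLp.toLp 2 (0, (F (WithLp.toLp 2 (0, X))).snd) :=
          alg_ext (h2 X) rfl
        have h' := F.norm_map (WithLp.toLp 2 (0, X))
        rw [h] at h'
        simpa using h' }
  have hS : Function.Surjective S := fun X => by
    refine ⟨(F.symm (WithLp.toLp 2 (X, 0))).fst, ?_⟩
    have h : F.symm (WithLp.toLp 2 (X, 0)) = WithLp.toLp 2 ((F.symm (WithLp.toLp 2 (X, 0))).fst, 0) :=
      alg_ext rfl (h1' X)
    change (F (WithLp.toLp 2 ((F.symm (WithLp.toLp 2 (X, 0))).fst, 0))).fst = X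
    rw [← h, F.apply_symm_apply]
    rfl
  have hT : Function.Surjective T := fun X => by
    refine ⟨(F.symm (WithLp.toLp 2 (0, X))).snd, ?_⟩
    have h : F.symm (WithLp.toLp 2 (0, X)) = WithLp.toLp 2 (0, (F.symm (WithLp.toLp 2 (0, X))).snd) :=
      alg_ext (h2' X) rfl
    change (F (WithLp.toLp 2 (0, (F.symm (WithLp.toLp 2 (0, X))).snd))).snd = X
    rw [← h, F.apply_symm_apply]
    rfl
  exact ⟨LinearIsometryEquiv.ofSurjective S hS, LinearIsometryEquiv.ofSurjective T hT,
    fun X => alg_ext rfl (h1 X), fun Z => alg_ext (h2 Z) rfl⟩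

/-- The orthogonal sum of two isometries. -/
def prodIsometry (S : Vec m ≃ₗᵢ[ℝ] Vec m') (T : Vec r ≃ₗᵢ[ℝ] Vec r') :
    Alg m r ≃ₗᵢ[ℝ] Alg m' r' where
  toFun A := WithLp.toLp 2 (S A.fst, T A.snd)
  invFun A := WithLp.toLp 2 (S.symm A.fst, T.symm A.snd)
  left_inv A := by apply alg_ext <;> simp
  right_inv A := by apply alg_ext <;> simp
  map_add' A B := by apply alg_ext <;> simp
  map_smul' c A := by apply alg_ext <;> simp
  norm_map' A := by simp [WithLp.prod_norm_eq_of_L2]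

/-- A curvature preserving isometry between metric Lie algebras of Heisenberg type can be replaced
by an isometric isomorphism of Lie algebras. -/
theorem PreservesCurvature.exists_bracket_isometry (hF : PreservesCurvature j j' F)
    (hj : IsHeisenbergType j) (hj' : IsHeisenbergType j') :
    ∃ Φ : Alg m r ≃ₗᵢ[ℝ] Alg m' r', ∀ a b, Φ (bracket j a b) = bracket j' (Φ a) (Φ b) := by
  by_cases h : m = 0 ∨ r = 0
  · refine ⟨F, fun a b => ?_⟩
    rw [bracket_eq_zero h, bracket_eq_zero (hF.degenerate_iff hj hj' h), map_zero]
  have h' : ¬ (m' = 0 ∨ r' = 0) := fun h' => h (hF.symm.degenerate_iff hj' hj h')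
  simp only [not_or, ← Nat.pos_iff_ne_zero] at h h'
  obtain ⟨S, T, hS, hT⟩ := hF.exists_blocks hj hj' h.1 h.2 h'.1 h'.2
  -- The structure j' transported to 𝔳 by the two blocks of `F`.
  let k : Vec r → Vec m →ₗ[ℝ] Vec m := fun Z =>
    S.symm.toLinearEquiv.toLinearMap ∘ₗ (j' (T Z) : Vec m' →L[ℝ] Vec m').toLinearMap ∘ₗ
      S.toLinearEquiv.toLinearMap
  have hk : ∀ Z X, S (k Z X) = (j' (T Z) : Vec m' →L[ℝ] Vec m') (S X) := fun Z X =>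
    S.apply_symm_apply _
  let l : Vec r →ₗ[ℝ] Vec m →ₗ[ℝ] Vec m :=
    LinearMap.mk₂ ℝ (fun Z X => (j Z : Vec m →L[ℝ] Vec m) X) (by simp) (by simp) (by simp) (by simp)
  have hskew : ∀ Z X Y, (inner ℝ (k Z X) Y : ℝ) = - inner ℝ X (k Z Y) := fun Z X Y => by
    rw [← S.inner_map_map, hk, inner_j_left, ← hk, S.inner_map_map]
  have hbr : ∀ X Y Z, T (bracketV j X ((j Z : Vec m →L[ℝ] Vec m) Y)) =
      bracketV j' (S X) ((j' (T Z) : Vec m' →L[ℝ] Vec m') (S Y)) := by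
    intro X Y Z
    have h := hF (WithLp.toLp 2 (X, 0)) (WithLp.toLp 2 (0, Z)) (WithLp.toLp 2 (Y, 0))
    rw [curvatureAlg_fst_snd_fst, hT, hS, hS, hT, curvatureAlg_fst_snd_fst, map_smul] at h
    have h2 := congrArg WithLp.snd h
    exact smul_right_injective _ (by norm_num : (1 / 4 : ℝ) ≠ 0) h2
  have hjk : ∀ Z Z' X, k Z (k Z' X) = l Z (l Z' X) := by
    intro Z Z' X
    refine ext_inner_left ℝ fun Y => ?_
    have h := congrArg (fun W => (inner ℝ (T Z) W : ℝ)) (hbr Y X Z')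
    simp only [T.inner_map_map, inner_bracketV] at h
    rw [← hk, ← hk, S.inner_map_map, inner_j_left, hskew] at h
    exact (neg_injective h).symm
  have hex : ∀ Z X, ∃ Z', k Z X = l Z' X := by
    intro Z X
    by_cases hX : X = 0
    · exact ⟨0, by rw [hX, map_zero, map_zero]⟩
    -- If k_Z X = j_{Z'} X, then [X, k_Z X] = |X|² Z', which dictates the witness. It is verified by
    -- comparing R(X, k_Z X)X on both sides.
    refine ⟨(‖X‖ ^ 2)⁻¹ • bracketV j X (k Z X), ?_⟩
    have h := hF (WithLp.toLp 2 (X, 0)) (WithLp.toLp 2 (k Z X, 0)) (WithLp.toLp 2 (X, 0))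
    rw [curvatureAlg_fst_fst_fst, hS, hS, hS, curvatureAlg_fst_fst_fst] at h
    have h2 := congrArg WithLp.fst h
    simp only [WithLp.toLp_fst, map_smul] at h2
    have h3 := smul_right_injective _ (by norm_num : (-(3 / 4) : ℝ) ≠ 0) h2
    have h4 : bracketV j' (S X) (S (k Z X)) = ‖X‖ ^ 2 • T Z := by
      rw [hk]
      refine ext_inner_left ℝ fun W => ?_
      rw [inner_bracketV, inner_j_j hj', inner_smul_right, S.norm_map, mul_comm]
    rw [h4, map_smul] at h3
    apply S.injective
    have hX' : ‖X‖ ^ 2 ≠ 0 := by simpa using hX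
    change S (k Z X) = S ((j ((‖X‖ ^ 2)⁻¹ • bracketV j X (k Z X)) : Vec m →L[ℝ] Vec m) X)
    rw [map_smul, SetLike.val_smul, smul_apply, map_smul, h3, SetLike.val_smul, smul_apply,
      inv_smul_smul₀ hX', hk]
  obtain ⟨U, ε, hε, hU⟩ := exists_isometry_sign (j := l) (k := k) (fun Z X Y => inner_j_left j Z X Y)
    hskew (fun Z X => hj Z X) hjk hex (e := EuclideanSpace.single ⟨0, h.2⟩ 1) (by simp)
  have hε' : ‖ε‖ = 1 := by
    rcases mul_self_eq_one_iff.1 hε with rfl | rfl <;> simp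
  -- The sign in k_Z U = ε U j_Z is moved to the centre as Z ↦ εZ.
  let V : Vec r ≃ₗᵢ[ℝ] Vec r :=
    { LinearEquiv.smulOfNeZero ℝ (Vec r) ε (fun h => by simp [h] at hε) with
      norm_map' := fun Z => by
        change ‖ε • Z‖ = ‖Z‖
        rw [norm_smul, hε', one_mul] }
  have hV : ∀ Z, V Z = ε • Z := fun Z => rfl
  refine ⟨prodIsometry (U.trans S) (V.trans T), fun a b => ?_⟩
  apply alg_ext
  · change (U.trans S) 0 = 0
    exact map_zero _
  change T (V (bracketV j a.fst b.fst)) = bracketV j' (S (U a.fst)) (S (U b.fst))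
  refine ext_inner_left ℝ fun W => ?_
  obtain ⟨W, rfl⟩ := T.surjective W
  rw [T.inner_map_map, hV, inner_smul_right, inner_bracketV, inner_bracketV, ← hk, S.inner_map_map,
    hU, inner_smul_left, U.inner_map_map]
  rfl

end CurvatureIsometries

/-! ### Lie brackets as commutators of derivations -/

section Derivations

open VectorField Bundle

variable {E : Type*} [NormedAddCommGroup E] [NormedSpace ℝ E]
  {H : Type*} [TopologicalSpace H] {I : ModelWithCorners ℝ E H}
  {N : Type*} [TopologicalSpace N] [ChartedSpace H N] [IsManifold I ∞ N]

theorem contMDiffAt_mvfderiv_apply {p : N} {f : N → ℝ} {U : (x : N) → TangentSpace I x}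
    (hf : CMDiffAt ∞ f p) (hU : CMDiffAt ∞ (T% U) p) :
    CMDiffAt ∞ (fun y => d% f y (U y)) p := by
  have h := ContMDiffAt.mfderiv_const (m := ∞) hf (by simp)
  have h2 := ContMDiffAt.clm_apply_of_inCoordinates (b₁ := id) (b₂ := f)
    (ϕ := fun x => mfderiv I 𝓘(ℝ, ℝ) f x) (v := U) h hU hf
  exact ((contMDiff_snd_tangentBundle_modelSpace ℝ 𝓘(ℝ, ℝ)).contMDiffAt).comp p h2

theorem eventually_contMDiffAt_section {p : N} {U : (x : N) → TangentSpace I x}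
    (hU : CMDiffAt ∞ (T% U) p) : ∀ᶠ y in nhds p, MDiffAt (T% U) y := by
  have h : CMDiffAt 1 (T% U) p := hU.of_le (by norm_cast)
  filter_upwards [(contMDiffAt_iff_contMDiffAt_nhds (by simp)).1 h] with y hy
  exact hy.mdifferentiableAt one_ne_zero

theorem eventually_mdifferentiableAt {p : N} {f : N → ℝ}
    (hf : CMDiffAt ∞ f p) : ∀ᶠ y in nhds p, MDiffAt f y := by
  have h : CMDiffAt 1 f p := hf.of_le (by norm_cast)
  filter_upwards [(contMDiffAt_iff_contMDiffAt_nhds (by simp)).1 h] with y hy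
  exact hy.mdifferentiableAt one_ne_zero

variable [CompleteSpace E]

theorem contMDiffAt_mlieBracket {p : N} {U V : (x : N) → TangentSpace I x}
    (hU : CMDiffAt ∞ (T% U) p) (hV : CMDiffAt ∞ (T% V) p) :
    CMDiffAt ∞ (T% (mlieBracket I U V)) p :=
  have : IsManifold I (((⊤ : ℕ∞) : WithTop ℕ∞) + 1) N := by
    simpa using! (inferInstance : IsManifold I ∞ N)
  have : IsManifold I (minSmoothness ℝ 2) N := by
    rw [minSmoothness_of_isRCLikeNormedField]
    exact IsManifold.of_le (n := ∞) (by norm_cast)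
  have : IsManifold I (minSmoothness ℝ 3) N := by
    rw [minSmoothness_of_isRCLikeNormedField]
    exact IsManifold.of_le (n := ∞) (by norm_cast)
  ContMDiffAt.mlieBracket_vectorField (n := ⊤) (m := ⊤) hU hV (by simp)

/-- Expanded for use in the Jacobi identity applied to U, V and fW, from which the action of [U, V]
on f can be read off as a coefficient of W. -/
theorem mlieBracket_mlieBracket_smul {p : N} {f : N → ℝ} {U V W : (x : N) → TangentSpace I x}
    (hf : CMDiffAt ∞ f p) (hV : CMDiffAt ∞ (T% V) p) (hW : CMDiffAt ∞ (T% W) p) :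
    mlieBracket I U (mlieBracket I V (f • W)) p =
      d% (fun y => d% f y (V y)) p (U p) • W p + d% f p (V p) • mlieBracket I U W p +
      (d% f p (U p) • mlieBracket I V W p +
        f p • mlieBracket I U (mlieBracket I V W) p) := by
  have hev : mlieBracket I V (f • W) =ᶠ[nhds p]
      (fun y => d% f y (V y)) • W + f • mlieBracket I V W := by
    filter_upwards [eventually_mdifferentiableAt hf, eventually_contMDiffAt_section hW] with y h1 h2
    exact mlieBracket_smul_right h1 h2
  have hg := contMDiffAt_mvfderiv_apply hf hV
  have hVW := contMDiffAt_mlieBracket hV hW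
  have e0 : (∞ : WithTop ℕ∞) ≠ 0 := by simp
  rw [Filter.EventuallyEq.mlieBracket_vectorField_eq (Filter.EventuallyEq.refl _ U) hev,
    mlieBracket_add_right, mlieBracket_smul_right, mlieBracket_smul_right]
  · exact hf.mdifferentiableAt e0
  · exact hVW.mdifferentiableAt e0
  · exact hg.mdifferentiableAt e0
  · exact hW.mdifferentiableAt e0
  · exact (hg.smul_section hW).mdifferentiableAt e0
  · exact (hf.smul_section hVW).mdifferentiableAt e0

/-- A Lie bracket acts on functions as the commutator of derivations. -/
theorem mvfderiv_mlieBracket {p : N} {f : N → ℝ} {U V : (x : N) → TangentSpace I x}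
    (hf : CMDiffAt ∞ f p) (hU : CMDiffAt ∞ (T% U) p) (hV : CMDiffAt ∞ (T% V) p) :
    d% f p (mlieBracket I U V p) =
      d% (fun y => d% f y (V y)) p (U p) - d% (fun y => d% f y (U y)) p (V p) := by
  -- Comparing coefficients of W requires W p ≠ 0; in a zero tangent space both sides vanish.
  by_cases h0 : ∀ w : TangentSpace I p, w = 0
  · rw [h0 (mlieBracket I U V p), h0 (U p), h0 (V p)]; simp
  push Not at h0
  obtain ⟨w, hw⟩ := h0
  set W : (x : N) → TangentSpace I x := FiberBundle.extend E w with hWdef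
  have hWp : W p = w := by simp [hWdef]
  have hW : CMDiffAt ∞ (T% W) p := FiberBundle.contMDiffAt_extend I E w
  have : IsManifold I (minSmoothness ℝ 3) N := by
    rw [minSmoothness_of_isRCLikeNormedField]
    exact IsManifold.of_le (n := ∞) (by norm_cast)
  have h2 : ∀ {Z : (x : N) → TangentSpace I x}, CMDiffAt ∞ (T% Z) p →
      CMDiffAt (minSmoothness ℝ 2) (T% Z) p := by
    intro Z hZ
    rw [minSmoothness_of_isRCLikeNormedField]
    exact hZ.of_le (by norm_cast)
  have J1 := leibniz_identity_mlieBracket_apply (h2 hU) (h2 hV) (h2 (hf.smul_section hW))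
  have J2 := leibniz_identity_mlieBracket_apply (h2 hU) (h2 hV) (h2 hW)
  have e0 : (∞ : WithTop ℕ∞) ≠ 0 := by simp
  change mlieBracket I U (mlieBracket I V (f • W)) p =
    mlieBracket I (mlieBracket I U V) (f • W) p +
      mlieBracket I V (mlieBracket I U (f • W)) p at J1
  rw [mlieBracket_mlieBracket_smul hf hV hW, mlieBracket_mlieBracket_smul hf hU hW,
    mlieBracket_smul_right (hf.mdifferentiableAt e0) (hW.mdifferentiableAt e0), J2, hWp] at J1
  -- Here e = [U, V]f, a = U(Vf) and f = V(Uf); all other terms of the Jacobi identity cancel.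
  have J4 : ∀ (a b c d e f : ℝ) (w x y z t : TangentSpace I p),
      a • w + b • x + (c • y + d • (z + t)) = (e • w + d • z) + (f • w + c • y + (b • x + d • t)) →
      (e - (a - f)) • w = 0 := by
    intro a b c d e f w x y z t h
    rw [← sub_eq_zero] at h
    rw [← neg_eq_zero, ← h]
    module
  have J3 : (d% f p (mlieBracket I U V p) -
      (d% (fun y => d% f y (V y)) p (U p) - d% (fun y => d% f y (U y)) p (V p))) • w = 0 := by
    exact J4 _ _ _ _ _ _ _ _ _ _ _ J1
  rcases smul_eq_zero.1 J3 with h | h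
  · exact sub_eq_zero.1 h
  · exact absurd h hw

end Derivations

/-! ### Tensoriality of the curvature of a covariant derivative -/

section CurvatureTensor

open VectorField Bundle Filter

variable {n : ℕ} {N : Type*} [TopologicalSpace N] [ChartedSpace (Vec n) N] [IsManifold (𝓡 n) ∞ N]

/-- Differentiability of a vector field at a point. -/
abbrev DiffVF (Y : (x : N) → TangentSpace (𝓡 n) x) (x : N) : Prop :=
  MDifferentiableAt (𝓡 n) (𝓡 n).tangent (fun y => (⟨y, Y y⟩ : TangentBundle (𝓡 n) N)) x

/-- Smoothness of a vector field at a point. -/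
abbrev SmoothVF (Y : (x : N) → TangentSpace (𝓡 n) x) (x : N) : Prop :=
  ContMDiffAt (𝓡 n) (𝓡 n).tangent ∞ (fun y => (⟨y, Y y⟩ : TangentBundle (𝓡 n) N)) x

theorem SmoothVF.diffVF {Y : (x : N) → TangentSpace (𝓡 n) x} {x : N} (h : SmoothVF Y x) :
    DiffVF Y x := h.mdifferentiableAt (by simp)

variable (D : CovariantDerivative (𝓡 n) (Vec n) (fun x : N => TangentSpace (𝓡 n) x))

theorem cov_congr {σ σ' : (x : N) → TangentSpace (𝓡 n) x} {p : N} (h : DiffVF σ p)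
    (he : σ =ᶠ[nhds p] σ') : D σ p = D σ' p := by
  refine D.isCovariantDerivativeOnUniv.congr_of_eventuallyEq h ?_ univ_mem he
  refine h.congr_of_eventuallyEq ?_
  filter_upwards [he] with y hy
  rw [hy]

theorem cov_add {σ σ' : (x : N) → TangentSpace (𝓡 n) x} {p : N} (h : DiffVF σ p)
    (h' : DiffVF σ' p) : D (σ + σ') p = D σ p + D σ' p :=
  D.isCovariantDerivativeOnUniv.add h h'

theorem cov_smul {σ : (x : N) → TangentSpace (𝓡 n) x} {f : N → ℝ} {p : N} (h : DiffVF σ p)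
    (hf : MDifferentiableAt (𝓡 n) 𝓘(ℝ, ℝ) f p) (u : TangentSpace (𝓡 n) p) :
    D (f • σ) p u = f p • D σ p u + mvfderiv (𝓡 n) f p u • σ p := by
  rw [D.isCovariantDerivativeOnUniv.leibniz h hf]
  simp

/-- The regularity needed to compute `R(X, Y) Z` at `p`. -/
structure HasSecondDeriv (X Y Z : (x : N) → TangentSpace (𝓡 n) x) (p : N) : Prop where
  diff : ∀ᶠ y in nhds p, DiffVF Z y
  left : DiffVF (fun y => D Z y (X y)) p
  right : DiffVF (fun y => D Z y (Y y)) p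

variable {D} {X Y Z Z' : (x : N) → TangentSpace (𝓡 n) x} {p : N} {f : N → ℝ}

theorem eventually_cov_add (h : ∀ᶠ y in nhds p, DiffVF Z y) (h' : ∀ᶠ y in nhds p, DiffVF Z' y)
    (X : (x : N) → TangentSpace (𝓡 n) x) :
    (fun y => D (Z + Z') y (X y)) =ᶠ[nhds p] (fun y => D Z y (X y)) + (fun y => D Z' y (X y)) := by
  filter_upwards [h, h'] with y h1 h2
  rw [cov_add D h1 h2]
  rfl

theorem eventually_cov_smul (h : ∀ᶠ y in nhds p, DiffVF Z y) (hf : ContMDiffAt (𝓡 n) 𝓘(ℝ, ℝ) ∞ f p)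
    (X : (x : N) → TangentSpace (𝓡 n) x) :
    (fun y => D (f • Z) y (X y)) =ᶠ[nhds p]
      f • (fun y => D Z y (X y)) + (fun y => mvfderiv (𝓡 n) f y (X y)) • Z := by
  filter_upwards [h, eventually_mdifferentiableAt hf] with y h1 h2
  rw [cov_smul D h1 h2]
  rfl

theorem DiffVF.congr {σ σ' : (x : N) → TangentSpace (𝓡 n) x} (h : DiffVF σ p)
    (he : σ' =ᶠ[nhds p] σ) : DiffVF σ' p := by
  refine MDifferentiableAt.congr_of_eventuallyEq h ?_
  filter_upwards [he] with y hy
  rw [hy]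

theorem DiffVF.add {σ σ' : (x : N) → TangentSpace (𝓡 n) x} (h : DiffVF σ p) (h' : DiffVF σ' p) :
    DiffVF (σ + σ') p := mdifferentiableAt_add_section h h'

theorem DiffVF.smul {σ : (x : N) → TangentSpace (𝓡 n) x}
    (hf : MDifferentiableAt (𝓡 n) 𝓘(ℝ, ℝ) f p) (h : DiffVF σ p) :
    DiffVF (f • σ) p := hf.smul_section h

theorem HasSecondDeriv.add (h : HasSecondDeriv D X Y Z p) (h' : HasSecondDeriv D X Y Z' p) :
    HasSecondDeriv D X Y (Z + Z') p where
  diff := by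
    filter_upwards [h.diff, h'.diff] with y h1 h2 using h1.add h2
  left := (h.left.add h'.left).congr (eventually_cov_add h.diff h'.diff X)
  right := (h.right.add h'.right).congr (eventually_cov_add h.diff h'.diff Y)

theorem HasSecondDeriv.smul (h : HasSecondDeriv D X Y Z p) (hf : ContMDiffAt (𝓡 n) 𝓘(ℝ, ℝ) ∞ f p)
    (hX : SmoothVF X p) (hY : SmoothVF Y p) :
    HasSecondDeriv D X Y (f • Z) p where
  diff := by
    filter_upwards [h.diff, eventually_mdifferentiableAt hf] with y h1 h2 using h1.smul h2
  left := ((h.left.smul (hf.mdifferentiableAt (by simp))).add (h.diff.self_of_nhds.smul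
    ((contMDiffAt_mvfderiv_apply hf hX).mdifferentiableAt (by simp)))).congr
    (eventually_cov_smul h.diff hf X)
  right := ((h.right.smul (hf.mdifferentiableAt (by simp))).add (h.diff.self_of_nhds.smul
    ((contMDiffAt_mvfderiv_apply hf hY).mdifferentiableAt (by simp)))).congr
    (eventually_cov_smul h.diff hf Y)

theorem eventually_cov_congr (h : ∀ᶠ y in nhds p, DiffVF Z y) (he : Z' =ᶠ[nhds p] Z)
    (X : (x : N) → TangentSpace (𝓡 n) x) :
    (fun y => D Z' y (X y)) =ᶠ[nhds p] (fun y => D Z y (X y)) := by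
  filter_upwards [h, he.eventuallyEq_nhds] with y h1 h2
  rw [cov_congr D h1 h2.symm]

theorem curvatureField_congr (h : HasSecondDeriv D X Y Z p) (he : Z' =ᶠ[nhds p] Z) :
    curvatureField D X Y Z' p = curvatureField D X Y Z p := by
  unfold curvatureField
  rw [cov_congr D h.diff.self_of_nhds he.symm,
    cov_congr D h.left (eventually_cov_congr h.diff he X).symm,
    cov_congr D h.right (eventually_cov_congr h.diff he Y).symm]

theorem HasSecondDeriv.zero : HasSecondDeriv D X Y 0 p := by
  have h0 : ∀ y : N, DiffVF (0 : (x : N) → TangentSpace (𝓡 n) x) y := fun y =>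
    mdifferentiableAt_zeroSection ..
  have h1 : ∀ W : (x : N) → TangentSpace (𝓡 n) x, (fun y => D 0 y (W y)) = 0 := by
    intro W; ext1 y; simp
  exact ⟨Eventually.of_forall h0, by rw [h1]; exact h0 p, by rw [h1]; exact h0 p⟩

theorem curvatureField_zero : curvatureField D X Y 0 p = 0 := by
  have h1 : ∀ W : (x : N) → TangentSpace (𝓡 n) x, (fun y => D 0 y (W y)) = 0 := by
    intro W; ext1 y; simp
  unfold curvatureField
  rw [h1 X, h1 Y]
  simp

theorem curvatureField_add (h : HasSecondDeriv D X Y Z p) (h' : HasSecondDeriv D X Y Z' p) :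
    curvatureField D X Y (Z + Z') p = curvatureField D X Y Z p + curvatureField D X Y Z' p := by
  have e1 := cov_congr D ((h.left.add h'.left).congr (eventually_cov_add h.diff h'.diff X))
    (eventually_cov_add h.diff h'.diff X)
  have e2 := cov_congr D ((h.right.add h'.right).congr (eventually_cov_add h.diff h'.diff Y))
    (eventually_cov_add h.diff h'.diff Y)
  unfold curvatureField
  rw [e1, e2, cov_add D h.left h'.left, cov_add D h.right h'.right,
    cov_add D h.diff.self_of_nhds h'.diff.self_of_nhds]
  simp only [_root_.add_apply]
  abel

/-- The first derivatives of f multiplying ∇Z cancel, and the second order terms combine to ([X, Y]f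
− X(Yf) + Y(Xf)) Z = 0. -/
theorem curvatureField_smul (h : HasSecondDeriv D X Y Z p) (hf : ContMDiffAt (𝓡 n) 𝓘(ℝ, ℝ) ∞ f p)
    (hX : SmoothVF X p) (hY : SmoothVF Y p) :
    curvatureField D X Y (f • Z) p = f p • curvatureField D X Y Z p := by
  have h1 := h.smul hf hX hY
  have hf' : MDifferentiableAt (𝓡 n) 𝓘(ℝ, ℝ) f p := hf.mdifferentiableAt (by simp)
  have hfX := (contMDiffAt_mvfderiv_apply hf hX).mdifferentiableAt (n := ∞) (by simp)
  have hfY := (contMDiffAt_mvfderiv_apply hf hY).mdifferentiableAt (n := ∞) (by simp)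
  have hZ := h.diff.self_of_nhds
  have e1 := cov_congr D h1.left (eventually_cov_smul h.diff hf X)
  have e2 := cov_congr D h1.right (eventually_cov_smul h.diff hf Y)
  unfold curvatureField
  rw [e1, e2, cov_add D (h.left.smul hf') (hZ.smul hfX), cov_add D (h.right.smul hf') (hZ.smul hfY)]
  simp only [_root_.add_apply]
  rw [cov_smul D h.left hf', cov_smul D h.right hf', cov_smul D hZ hfX, cov_smul D hZ hfY,
    cov_smul D hZ hf', mvfderiv_mlieBracket hf hX hY]
  module

theorem curvatureField_sum {ι : Type*} (s : Finset ι) (f : ι → N → ℝ)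
    (Z : ι → (x : N) → TangentSpace (𝓡 n) x) (h : ∀ i, HasSecondDeriv D X Y (Z i) p)
    (hf : ∀ i, ContMDiffAt (𝓡 n) 𝓘(ℝ, ℝ) ∞ (f i) p) (hX : SmoothVF X p) (hY : SmoothVF Y p) :
    HasSecondDeriv D X Y (∑ i ∈ s, f i • Z i) p ∧
      curvatureField D X Y (∑ i ∈ s, f i • Z i) p = ∑ i ∈ s, f i p • curvatureField D X Y (Z i) p := by
  classical
  induction s using Finset.induction_on with
  | empty => exact ⟨HasSecondDeriv.zero, curvatureField_zero⟩
  | insert a s ha ih =>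
    have h1 := (h a).smul (hf a) hX hY
    rw [Finset.sum_insert ha, Finset.sum_insert ha]
    exact ⟨h1.add ih.1, by rw [curvatureField_add h1 ih.1, curvatureField_smul (h a) (hf a) hX hY,
      ih.2]⟩

/-- The term −(Yf)∇_X Z coming from [fX, Y] cancels the derivative of f in ∇_Y(f ∇_X Z). -/
theorem tensorialAt_curvatureField_left
    (hD : ∀ X, DiffVF X p → DiffVF (fun y => D Z y (X y)) p) :
    TensorialAt (𝓡 n) (Vec n) (fun X => curvatureField D X Y Z p) p where
  smul := by
    intro f X hf hX
    have e1 : (fun y => D Z y ((f • X) y)) = f • (fun y => D Z y (X y)) := by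
      ext1 y; simp
    have e2 : (f • X) p = f p • X p := rfl
    unfold curvatureField
    rw [e1, cov_smul D (hD X hX) hf, e2, mlieBracket_smul_left hf hX]
    simp only [map_add, map_smul, _root_.map_neg, neg_smul]
    module
  add := by
    intro X X' hX hX'
    have e1 : (fun y => D Z y ((X + X') y)) = (fun y => D Z y (X y)) + (fun y => D Z y (X' y)) := by
      ext1 y; simp
    have e2 : (X + X') p = X p + X' p := rfl
    unfold curvatureField
    rw [e1, cov_add D (hD X hX) (hD X' hX'), e2, mlieBracket_add_left hX hX']
    simp only [map_add, _root_.add_apply]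
    abel

theorem curvatureField_swap : curvatureField D X Y Z p = - curvatureField D Y X Z p := by
  unfold curvatureField
  rw [mlieBracket_swap_apply, map_neg]
  abel

/-- `R(X, Y) Z` depends only on the values of `X` and `Y`. -/
theorem curvatureField_pointwise {X' Y' : (x : N) → TangentSpace (𝓡 n) x}
    (hD : ∀ X, DiffVF X p → DiffVF (fun y => D Z y (X y)) p)
    (hX : DiffVF X p) (hX' : DiffVF X' p) (hY : DiffVF Y p) (hY' : DiffVF Y' p)
    (hXX : X p = X' p) (hYY : Y p = Y' p) :
    curvatureField D X Y Z p = curvatureField D X' Y' Z p := by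
  rw [(tensorialAt_curvatureField_left hD).pointwise hX hX' hXX, curvatureField_swap,
    (tensorialAt_curvatureField_left hD).pointwise hY hY' hYY, ← curvatureField_swap]

end CurvatureTensor

/-! ### Connection and curvature in a Lie frame -/

section Frames

open VectorField Bundle Filter

variable {m r : ℕ} {j : Vec r →ₗ[ℝ] So m}
  {n : ℕ} {N : Type*} [TopologicalSpace N] [ChartedSpace (Vec n) N] [IsManifold (𝓡 n) ∞ N]
  [RiemannianBundle (fun x : N => TangentSpace (𝓡 n) x)]

/-- A smooth orthonormal frame on `U`, parametrised by `𝔤(j)`, whose Lie brackets are those of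
`𝔤(j)`. -/
structure IsLieFrame (j : Vec r →ₗ[ℝ] So m) (E : (x : N) → Alg m r →ₗ[ℝ] TangentSpace (𝓡 n) x)
    (U : Set N) : Prop where
  isOpen : IsOpen U
  smooth : ∀ x ∈ U, ∀ A, SmoothVF (fun y => E y A) x
  inner_eq : ∀ x ∈ U, ∀ A B, inner ℝ (E x A) (E x B) = (inner ℝ A B : ℝ)
  lieBracket_eq : ∀ x ∈ U, ∀ A B,
    mlieBracket (𝓡 n) (fun y => E y A) (fun y => E y B) x = E x (bracket j A B)
  surj : ∀ x ∈ U, Function.Surjective (E x)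

variable {E : (x : N) → Alg m r →ₗ[ℝ] TangentSpace (𝓡 n) x} {U : Set N}
  {D : CovariantDerivative (𝓡 n) (Vec n) (fun x : N => TangentSpace (𝓡 n) x)} {p : N}

/-- Inner products of frame fields are locally constant, so the derivative in metric compatibility
vanishes. -/
theorem IsLieFrame.metric (hE : IsLieFrame j E U) (hD : IsLeviCivita D) (hp : p ∈ U)
    (A B : Alg m r) (u : TangentSpace (𝓡 n) p) :
    inner ℝ (D (fun y => E y A) p u) (E p B) + inner ℝ (E p A) (D (fun y => E y B) p u) = (0 : ℝ) := by
  have h := hD.metric p (fun y => E y A) (fun y => E y B) (hE.smooth p hp A).diffVF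
    (hE.smooth p hp B).diffVF u
  rw [← h]
  have hev : (fun y => (inner ℝ (E y A) (E y B) : ℝ)) =ᶠ[nhds p] fun _ => (inner ℝ A B : ℝ) := by
    filter_upwards [hE.isOpen.mem_nhds hp] with y hy using hE.inner_eq y hy A B
  rw [hev.mfderiv_eq, mfderiv_const]
  rfl

theorem IsLieFrame.torsion (hE : IsLieFrame j E U) (hD : IsLeviCivita D) (hp : p ∈ U)
    (A B : Alg m r) :
    D (fun y => E y B) p (E p A) = D (fun y => E y A) p (E p B) + E p (bracket j A B) := by
  have h := (D.torsion_eq_zero_iff.1 hD.torsion_free) (hE.smooth p hp A).diffVF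
    (hE.smooth p hp B).diffVF
  rw [hE.lieBracket_eq p hp] at h
  rw [← h]; abel

/-- The Levi-Civita connection in a frame, from the Koszul formula. -/
theorem IsLieFrame.cov_apply (hE : IsLieFrame j E U) (hD : IsLeviCivita D) (hp : p ∈ U)
    (A B : Alg m r) : D (fun y => E y B) p (E p A) = E p (nablaAlg j A B) := by
  refine ext_inner_right ℝ fun w => ?_
  obtain ⟨C, rfl⟩ := hE.surj p hp w
  have m1 := hE.metric hD hp B C (E p A)
  have m2 := hE.metric hD hp C A (E p B)
  have m3 := hE.metric hD hp A B (E p C)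
  have t1 := congrArg (fun w => (inner ℝ w (E p C) : ℝ)) (hE.torsion hD hp A B)
  have t2 := congrArg (fun w => (inner ℝ w (E p A) : ℝ)) (hE.torsion hD hp B C)
  have t3 := congrArg (fun w => (inner ℝ w (E p B) : ℝ)) (hE.torsion hD hp A C)
  simp only [inner_add_left, hE.inner_eq p hp] at t1 t2 t3
  rw [hE.inner_eq p hp]
  have k := inner_nablaAlg j A B C
  rw [real_inner_comm (D (fun y => E y C) p (E p A)) (E p B)] at m1
  rw [real_inner_comm (D (fun y => E y A) p (E p B)) (E p C)] at m2
  rw [real_inner_comm (D (fun y => E y B) p (E p C)) (E p A)] at m3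
  rw [real_inner_comm (bracket j B C) A, real_inner_comm (bracket j A C) B] at k
  linarith

theorem IsLieFrame.expansion (hE : IsLieFrame j E U) (hp : p ∈ U) (u : TangentSpace (𝓡 n) p) :
    u = ∑ i, (inner ℝ u (E p (stdOrthonormalBasis ℝ (Alg m r) i)) : ℝ) •
      E p (stdOrthonormalBasis ℝ (Alg m r) i) := by
  obtain ⟨A, rfl⟩ := hE.surj p hp u
  conv_lhs => rw [← (stdOrthonormalBasis ℝ (Alg m r)).sum_repr' A]
  rw [map_sum]
  refine Finset.sum_congr rfl fun i _ => ?_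
  rw [map_smul, hE.inner_eq p hp, real_inner_comm]

variable [IsContMDiffRiemannianBundle (𝓡 n) ∞ (Vec n) (fun x : N => TangentSpace (𝓡 n) x)]

/-- No smoothness of `D` is assumed. It comes from the Koszul formula: on frame fields `D` has
constant coefficients, so ∇_X of a frame field is as regular as X. -/
theorem IsLieFrame.diffVF_cov (hE : IsLieFrame j E U) (hD : IsLeviCivita D) (hp : p ∈ U)
    (C : Alg m r) {X : (x : N) → TangentSpace (𝓡 n) x} (hX : DiffVF X p) :
    DiffVF (fun y => D (fun z => E z C) y (X y)) p := by
  have : IsContMDiffRiemannianBundle (𝓡 n) 1 (Vec n) (fun x : N => TangentSpace (𝓡 n) x) :=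
    IsContMDiffRiemannianBundle.of_le (n := ∞) (by norm_cast)
  set b := stdOrthonormalBasis ℝ (Alg m r) with hb
  have h1 : DiffVF (fun y => ∑ i, (inner ℝ (X y) (E y (b i)) : ℝ) • E y (nablaAlg j (b i) C)) p :=
    MDifferentiableAt.sum_section fun i _ =>
      MDifferentiableAt.smul_section (hX.inner_bundle (hE.smooth p hp (b i)).diffVF)
        (hE.smooth p hp _).diffVF
  refine h1.congr ?_
  filter_upwards [hE.isOpen.mem_nhds hp] with y hy
  conv_lhs => rw [hE.expansion hy (X y)]
  rw [map_sum]
  refine Finset.sum_congr rfl fun i _ => ?_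
  rw [map_smul, hE.cov_apply hD hy]

theorem IsLieFrame.curvatureField_eq (hE : IsLieFrame j E U) (hD : IsLeviCivita D) (hp : p ∈ U)
    (A B C : Alg m r) :
    curvatureField D (fun y => E y A) (fun y => E y B) (fun y => E y C) p =
      E p (curvatureAlg j A B C) := by
  have key : ∀ A B C : Alg m r, D (fun y => D (fun z => E z C) y (E y B)) p (E p A) =
      E p (nablaAlg j A (nablaAlg j B C)) := by
    intro A B C
    rw [← hE.cov_apply hD hp, cov_congr D (hE.diffVF_cov hD hp C (hE.smooth p hp B).diffVF)]
    filter_upwards [hE.isOpen.mem_nhds hp] with y hy using hE.cov_apply hD hy B C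
  unfold curvatureField curvatureAlg
  rw [hE.lieBracket_eq p hp, key, key, hE.cov_apply hD hp, map_sub, map_sub]

/-- The extensions defining `curvature` need not be frame fields. Near p the third one is expanded
in the frame, and its coefficients come out by linearity over functions; the other two may be
replaced by frame fields with the same values at p. -/
theorem IsLieFrame.curvature_apply (hE : IsLieFrame j E U) (hD : IsLeviCivita D) (hp : p ∈ U)
    (A B C : Alg m r) :
    curvature D p (E p A) (E p B) (E p C) = E p (curvatureAlg j A B C) := by
  set b := stdOrthonormalBasis ℝ (Alg m r) with hb
  have hs : ∀ u : TangentSpace (𝓡 n) p,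
      SmoothVF (FiberBundle.extend (Vec n) u : (x : N) → TangentSpace (𝓡 n) x) p := fun u =>
    FiberBundle.contMDiffAt_extend (𝓡 n) (Vec n) u
  set X : (x : N) → TangentSpace (𝓡 n) x := FiberBundle.extend (Vec n) (E p A) with hX
  set Y : (x : N) → TangentSpace (𝓡 n) x := FiberBundle.extend (Vec n) (E p B) with hY
  set Z : (x : N) → TangentSpace (𝓡 n) x := FiberBundle.extend (Vec n) (E p C) with hZ
  let F : Fin (Module.finrank ℝ (Alg m r)) → (x : N) → TangentSpace (𝓡 n) x := fun i y => E y (b i)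
  let f : Fin (Module.finrank ℝ (Alg m r)) → N → ℝ := fun i y => inner ℝ (Z y) (F i y)
  let G : (x : N) → TangentSpace (𝓡 n) x := ∑ i, f i • F i
  have hG : ∀ y, G y = ∑ i, f i y • F i y := fun y => Finset.sum_apply _ _ _
  have hev : Z =ᶠ[nhds p] G := by
    filter_upwards [hE.isOpen.mem_nhds hp] with y hy
    exact (hE.expansion hy (Z y)).trans (hG y).symm
  have h2 : ∀ i, HasSecondDeriv D X Y (F i) p := fun i =>
    ⟨by filter_upwards [hE.isOpen.mem_nhds hp] with y hy using (hE.smooth y hy _).diffVF,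
      hE.diffVF_cov hD hp _ (hs _).diffVF, hE.diffVF_cov hD hp _ (hs _).diffVF⟩
  have hsum := curvatureField_sum Finset.univ f F h2
    (fun i => (hs _).inner_bundle (hE.smooth p hp (b i))) (hs _) (hs _)
  have hi : ∀ i, curvatureField D X Y (F i) p = E p (curvatureAlg j A B (b i)) := by
    intro i
    rw [← hE.curvatureField_eq hD hp]
    exact curvatureField_pointwise (fun W hW => hE.diffVF_cov hD hp _ hW) (hs _).diffVF
      (hE.smooth p hp A).diffVF (hs _).diffVF (hE.smooth p hp B).diffVF (by simp [hX]) (by simp [hY])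
  have hZp : Z p = E p C := by simp [hZ]
  change curvatureField D X Y Z p = _
  rw [curvatureField_congr hsum.1 hev, hsum.2]
  simp only [hi, f, F, hZp, hE.inner_eq p hp]
  simp only [← map_smul, ← map_sum, ← curvatureHom_apply]
  congr 2
  conv_rhs => rw [← b.sum_repr' C]
  exact Finset.sum_congr rfl fun i _ => by rw [real_inner_comm]

end Frames

/-! ### Affine vector fields on a vector space -/

section LinearFields

open VectorField Bundle

variable {E : Type*} [NormedAddCommGroup E] [NormedSpace ℝ E] [FiniteDimensional ℝ E]

theorem hasFDerivAt_const_add_linear (c : E) (L : E →ₗ[ℝ] E) (x : E) :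
    HasFDerivAt (fun x => c + L x) (LinearMap.toContinuousLinearMap L) x :=
  (LinearMap.toContinuousLinearMap L).hasFDerivAt.const_add c

theorem mfderiv_const_add_linear (c : E) (L : E →ₗ[ℝ] E) (x v : E) :
    (mfderiv 𝓘(ℝ, E) 𝓘(ℝ, E) (fun x => c + L x) x : E →L[ℝ] E) v = L v := by
  rw [mfderiv_eq_fderiv, (hasFDerivAt_const_add_linear c L x).fderiv]
  rfl

theorem contDiff_const_add_linear (c : E) (L : E →ₗ[ℝ] E) : ContDiff ℝ ∞ (fun x => c + L x) :=
  contDiff_const.add (LinearMap.toContinuousLinearMap L).contDiff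

theorem contMDiffAt_section_const_add_linear (c : E) (L : E →ₗ[ℝ] E) (x : E) :
    ContMDiffAt 𝓘(ℝ, E) 𝓘(ℝ, E).tangent ∞
      (fun x => (⟨x, c + L x⟩ : TangentBundle 𝓘(ℝ, E) E)) x :=
  contMDiffAt_vectorSpace_iff_contDiffAt.2 (contDiff_const_add_linear c L).contDiffAt

theorem mlieBracket_const_add_linear (c c' : E) (L L' : E →ₗ[ℝ] E) (x : E) :
    (mlieBracket 𝓘(ℝ, E) (fun x : E => (c + L x : E)) (fun x : E => (c' + L' x : E)) x : E) =
      L' (c + L x) - L (c' + L' x) := by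
  have h : ∀ V W : (x : E) → TangentSpace 𝓘(ℝ, E) x,
      mlieBracket 𝓘(ℝ, E) V W x = lieBracket ℝ V W x := fun V W => by
    rw [← mlieBracketWithin_univ, mlieBracketWithin_eq_lieBracketWithin]
    exact congrFun lieBracketWithin_univ x
  refine (h _ _).trans ?_
  unfold lieBracket
  rw [(hasFDerivAt_const_add_linear c L x).fderiv, (hasFDerivAt_const_add_linear c' L' x).fderiv]
  rfl

end LinearFields

/-! ### Left invariant fields and metric on the group -/

section LeftInvariant

open VectorField Bundle Filter

variable {m r : ℕ} (j : Vec r →ₗ[ℝ] So m)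

/-- The value at `a` of the left invariant vector fields of `G(j)`. -/
def leftField (a : Alg m r) : Alg m r →ₗ[ℝ] Alg m r :=
  LinearMap.id + (1 / 2 : ℝ) • bracket j a

theorem leftField_apply (a A : Alg m r) : leftField j a A = A + (1 / 2 : ℝ) • bracket j a A := rfl

theorem leftField_neg_leftField (a A : Alg m r) : leftField j (-a) (leftField j a A) = A := by
  simp only [leftField_apply, map_add, map_smul, map_neg, LinearMap.neg_apply,
    bracket_bracket_right]
  module

theorem leftField_leftField_neg (a A : Alg m r) : leftField j a (leftField j (-a) A) = A := by
  have h := leftField_neg_leftField j (-a) A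
  rwa [neg_neg] at h

theorem mulGrp_eq (a : Alg m r) : mulGrp j a = fun b => a + leftField j a b := by
  ext1 b
  rw [mulGrp, leftField_apply, add_assoc]

/-- In exponential coordinates of a two-step group, left translation is affine, so its differential
does not depend on the base point. -/
theorem mfderiv_mulGrp (a b v : Alg m r) :
    (mfderiv 𝓘(ℝ, Alg m r) 𝓘(ℝ, Alg m r) (mulGrp j a) b : Alg m r →L[ℝ] Alg m r) v =
      leftField j a v := by
  rw [mulGrp_eq]
  exact mfderiv_const_add_linear a (leftField j a) b v

theorem contDiff_mulGrp (a : Alg m r) : ContDiff ℝ ∞ (mulGrp j a) := by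
  rw [mulGrp_eq]
  exact contDiff_const_add_linear a (leftField j a)

theorem leftField_mulGrp (a b A : Alg m r) :
    leftField j (mulGrp j a b) A = leftField j a (leftField j b A) := by
  simp only [leftField_apply, mulGrp, map_add, map_smul, LinearMap.add_apply, LinearMap.smul_apply,
    bracket_bracket_left, bracket_bracket_right]
  module

theorem contMDiffAt_leftField (a A : Alg m r) :
    ContMDiffAt 𝓘(ℝ, Alg m r) 𝓘(ℝ, Alg m r).tangent ∞
      (fun a => (⟨a, leftField j a A⟩ : TangentBundle 𝓘(ℝ, Alg m r) (Alg m r))) a :=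
  contMDiffAt_section_const_add_linear A ((1 / 2 : ℝ) • (bracket j).flip A) a

/-- Each field a ↦ A + [a, A]/2 is affine. The two derivatives contribute half of [A, B] each;
corrections by a vanish because brackets are central. -/
theorem mlieBracket_leftField (a A B : Alg m r) :
    (mlieBracket 𝓘(ℝ, Alg m r) (fun a : Alg m r => (leftField j a A : Alg m r))
      (fun a : Alg m r => (leftField j a B : Alg m r)) a : Alg m r) =
      leftField j a (bracket j A B) := by
  refine (mlieBracket_const_add_linear A B ((1 / 2 : ℝ) • (bracket j).flip A)
    ((1 / 2 : ℝ) • (bracket j).flip B) a).trans ?_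
  simp only [LinearMap.smul_apply, LinearMap.flip_apply, map_add, map_smul, leftField_apply,
    bracket_bracket_left, bracket_bracket_right, smul_zero, add_zero, bracket_swap j B A]
  rw [smul_neg, sub_neg_eq_add, ← add_smul, add_halves, one_smul]

theorem leftInvMetric_leftField (a : Alg m r) (A B : Alg m r) :
    leftInvMetric j a (leftField j a A) (leftField j a B) = inner ℝ A B := by
  have h : ∀ A, (mfderiv 𝓘(ℝ, Alg m r) 𝓘(ℝ, Alg m r) (mulGrp j (-a)) a : Alg m r →L[ℝ] Alg m r)
      (leftField j a A) = A := fun A => by rw [mfderiv_mulGrp, leftField_neg_leftField]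
  exact congrArg₂ (fun x y : Alg m r => (inner ℝ x y : ℝ)) (h A) (h B)

end LeftInvariant

/-! ### Descent of left invariant frames to the quotient -/

section Quotients

open VectorField Bundle Filter

variable {m r : ℕ} {j : Vec r →ₗ[ℝ] So m}
  {n : ℕ} {N : Type*} [TopologicalSpace N] [ChartedSpace (Vec n) N]
  [RiemannianBundle (fun x : N => TangentSpace (𝓡 n) x)]

/-- Local isometries from `G(j)` to a Riemannian manifold. -/
structure IsLocalIsometryFrom (j : Vec r →ₗ[ℝ] So m) (pr : Alg m r → N) : Prop where
  isLocalDiffeomorph : IsLocalDiffeomorph 𝓘(ℝ, Alg m r) (𝓡 n) ∞ pr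
  inner_eq : ∀ a A B, inner ℝ (mfderiv 𝓘(ℝ, Alg m r) (𝓡 n) pr a (leftField j a A))
    (mfderiv 𝓘(ℝ, Alg m r) (𝓡 n) pr a (leftField j a B)) = (inner ℝ A B : ℝ)

theorem IsNilmanifold.exists_localIsometry (hN : IsNilmanifold j n N) :
    ∃ pr : Alg m r → N, Function.Surjective pr ∧ IsLocalIsometryFrom (n := n) j pr := by
  obtain ⟨Γ, pr, -, hs, -, hloc, hmet⟩ := hN.exists_quotient
  refine ⟨pr, hs, hloc, fun a A B => ?_⟩
  rw [← leftInvMetric_leftField j a A B]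
  exact hmet a (leftField j a A) (leftField j a B)

theorem IsLocalIsometryFrom.mfderiv_comp_localInverse {pr : Alg m r → N}
    (h : IsLocalIsometryFrom (n := n) j pr) (a : Alg m r) {y : N}
    (hy : y ∈ (h.isLocalDiffeomorph a).localInverse.source) (v : TangentSpace (𝓡 n) y) :
    (mfderiv 𝓘(ℝ, Alg m r) (𝓡 n) pr ((h.isLocalDiffeomorph a).localInverse y)
      (mfderiv (𝓡 n) 𝓘(ℝ, Alg m r) (h.isLocalDiffeomorph a).localInverse y v) : Vec n) = v := by
  set Ψ := (h.isLocalDiffeomorph a).localInverse with hΨ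
  have h1 : MDifferentiableAt (𝓡 n) 𝓘(ℝ, Alg m r) Ψ y :=
    (Ψ.contMDiffOn.contMDiffAt (Ψ.open_source.mem_nhds hy)).mdifferentiableAt (by simp)
  have h2 : MDifferentiableAt 𝓘(ℝ, Alg m r) (𝓡 n) pr (Ψ y) :=
    h.isLocalDiffeomorph.contMDiff.mdifferentiableAt (by simp)
  have h3 := mfderiv_comp y h2 h1
  have h4 : pr ∘ Ψ =ᶠ[nhds y] id := by
    filter_upwards [Ψ.open_source.mem_nhds hy] with z hz
      using (h.isLocalDiffeomorph a).localInverse_eqOn_right hz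
  have h5 := h3.symm.trans h4.mfderiv_eq
  have h6 := DFunLike.congr_fun h5 v
  refine h6.trans ?_
  rw [mfderiv_id]
  rfl

theorem IsLocalIsometryFrom.inner_mfderiv_localInverse {pr : Alg m r → N}
    (h : IsLocalIsometryFrom (n := n) j pr) (a : Alg m r) {y : N}
    (hy : y ∈ (h.isLocalDiffeomorph a).localInverse.source) (u v : TangentSpace (𝓡 n) y)
    (A B : Alg m r)
    (hA : leftField j ((h.isLocalDiffeomorph a).localInverse y) A =
      mfderiv (𝓡 n) 𝓘(ℝ, Alg m r) (h.isLocalDiffeomorph a).localInverse y u)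
    (hB : leftField j ((h.isLocalDiffeomorph a).localInverse y) B =
      mfderiv (𝓡 n) 𝓘(ℝ, Alg m r) (h.isLocalDiffeomorph a).localInverse y v) :
    (inner ℝ u v : ℝ) = inner ℝ A B := by
  rw [← h.inner_eq ((h.isLocalDiffeomorph a).localInverse y)]
  have e : pr ((h.isLocalDiffeomorph a).localInverse y) = y :=
    (h.isLocalDiffeomorph a).localInverse_eqOn_right hy
  have hu := h.mfderiv_comp_localInverse a hy u
  have hv := h.mfderiv_comp_localInverse a hy v
  rw [← hA] at hu
  rw [← hB] at hv
  -- The inner product depends on the fibre, so vectors over pr(Ψ y) are transported to y by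
  -- substituting the equality of base points.
  have key : ∀ (q : N) (_ : q = y) (s t : TangentSpace (𝓡 n) q)
      (_ : (s : Vec n) = u) (_ : (t : Vec n) = v),
      (inner ℝ s t : ℝ) = inner ℝ u v := by
    rintro q rfl s t rfl rfl
    rfl
  exact (key _ e _ _ hu hv).symm

variable [IsManifold (𝓡 n) ∞ N]

/-- The frame is the pullback of the left invariant fields under a local inverse Ψ of `pr`;
naturality of the Lie bracket under pullback gives the structure constants. -/
theorem IsLocalIsometryFrom.exists_frame {pr : Alg m r → N} (h : IsLocalIsometryFrom (n := n) j pr)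
    (a : Alg m r) : ∃ (E : (x : N) → Alg m r →ₗ[ℝ] TangentSpace (𝓡 n) x) (U : Set N),
      IsLieFrame j E U ∧ pr a ∈ U := by
  set Ψ := (h.isLocalDiffeomorph a).localInverse with hΨ
  have hinv : ∀ y ∈ Ψ.source, (mfderiv (𝓡 n) 𝓘(ℝ, Alg m r) Ψ y).IsInvertible := fun y hy =>
    ⟨(Ψ.isLocalDiffeomorphAt _ _ _ hy).mfderivToContinuousLinearEquiv (by simp), rfl⟩
  have hsm : ∀ y ∈ Ψ.source, ContMDiffAt (𝓡 n) 𝓘(ℝ, Alg m r) ∞ Ψ y := fun y hy =>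
    Ψ.contMDiffOn.contMDiffAt (Ψ.open_source.mem_nhds hy)
  have e2 : IsManifold (𝓡 n) (minSmoothness ℝ 3) N := by
    rw [minSmoothness_of_isRCLikeNormedField]
    exact IsManifold.of_le (n := ∞) (by norm_cast)
  refine ⟨fun y => (mfderiv (𝓡 n) 𝓘(ℝ, Alg m r) Ψ y).inverse.toLinearMap ∘ₗ leftField j (Ψ y),
    Ψ.source, ⟨Ψ.open_source, ?_, ?_, ?_, ?_⟩, (h.isLocalDiffeomorph a).localInverse_mem_source⟩
  · intro x hx A
    exact ContMDiffAt.mpullback_vectorField_preimage (contMDiffAt_leftField j (Ψ x) A) (hsm x hx)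
      (hinv x hx) (by simp)
  · intro x hx A B
    have hk : ∀ A : Alg m r, leftField j (Ψ x) A = mfderiv (𝓡 n) 𝓘(ℝ, Alg m r) Ψ x
        ((mfderiv (𝓡 n) 𝓘(ℝ, Alg m r) Ψ x).inverse (leftField j (Ψ x) A)) := fun A =>
      ((hinv x hx).self_apply_inverse _).symm
    exact h.inner_mfderiv_localInverse a hx _ _ A B (hk A) (hk B)
  · intro x hx A B
    have := mpullback_mlieBracket (n := ∞) (contMDiffAt_leftField j (Ψ x) A |>.mdifferentiableAt (by simp))
      (contMDiffAt_leftField j (Ψ x) B |>.mdifferentiableAt (by simp)) (hsm x hx)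
      (by rw [minSmoothness_of_isRCLikeNormedField]; norm_cast)
    refine this.symm.trans ?_
    rw [mpullback_apply]
    exact congrArg (mfderiv (𝓡 n) 𝓘(ℝ, Alg m r) Ψ x).inverse (mlieBracket_leftField j (Ψ x) A B)
  · intro x hx u
    refine ⟨leftField j (-Ψ x) (mfderiv (𝓡 n) 𝓘(ℝ, Alg m r) Ψ x u), ?_⟩
    refine (congrArg (mfderiv (𝓡 n) 𝓘(ℝ, Alg m r) Ψ x).inverse
      (leftField_leftField_neg j (Ψ x) _)).trans ?_
    exact (hinv x hx).inverse_apply_self _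

end Quotients

/-! ### Local isometries induced by Lie algebra isomorphisms -/

section Isometries

open Bundle Filter

variable {m r m' r' : ℕ} {j : Vec r →ₗ[ℝ] So m} {j' : Vec r' →ₗ[ℝ] So m'}

theorem mulGrp_neg_mulGrp (j : Vec r →ₗ[ℝ] So m) (a x : Alg m r) :
    mulGrp j (-a) (mulGrp j a x) = x := by
  rw [← mulGrp_assoc, neg_mulGrp, zero_mulGrp]

theorem mulGrp_mulGrp_neg (j : Vec r →ₗ[ℝ] So m) (a x : Alg m r) :
    mulGrp j a (mulGrp j (-a) x) = x := by
  have h := mulGrp_neg_mulGrp j (-a) x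
  rwa [neg_neg] at h

/-- The map `x ↦ a' Φ(a⁻¹ x)` from `G(j)` to `G(j')`. -/
def translate (j : Vec r →ₗ[ℝ] So m) (j' : Vec r' →ₗ[ℝ] So m') (Φ : Alg m r ≃ₗᵢ[ℝ] Alg m' r')
    (a : Alg m r) (a' : Alg m' r') (x : Alg m r) : Alg m' r' :=
  mulGrp j' a' (Φ (mulGrp j (-a) x))

theorem contDiff_translate (Φ : Alg m r ≃ₗᵢ[ℝ] Alg m' r') (a : Alg m r) (a' : Alg m' r') :
    ContDiff ℝ ∞ (translate j j' Φ a a') :=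
  (contDiff_mulGrp j' a').comp (Φ.contDiff.comp (contDiff_mulGrp j (-a)))

theorem translate_symm_translate (Φ : Alg m r ≃ₗᵢ[ℝ] Alg m' r') (a : Alg m r) (a' : Alg m' r')
    (x : Alg m r) : translate j' j Φ.symm a' a (translate j j' Φ a a' x) = x := by
  simp only [translate, mulGrp_neg_mulGrp, Φ.symm_apply_apply, mulGrp_mulGrp_neg]

/-- `translate` as a diffeomorphism. -/
def translateDiffeo (j : Vec r →ₗ[ℝ] So m) (j' : Vec r' →ₗ[ℝ] So m')
    (Φ : Alg m r ≃ₗᵢ[ℝ] Alg m' r') (a : Alg m r) (a' : Alg m' r') :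
    PartialDiffeomorph 𝓘(ℝ, Alg m r) 𝓘(ℝ, Alg m' r') (Alg m r) (Alg m' r') ∞ where
  toPartialEquiv := Equiv.toPartialEquiv
    { toFun := translate j j' Φ a a'
      invFun := translate j' j Φ.symm a' a
      left_inv := translate_symm_translate Φ a a'
      right_inv := fun x => by
        have h := translate_symm_translate (j := j') (j' := j) Φ.symm a' a x
        rwa [Φ.symm_symm] at h }
  open_source := isOpen_univ
  open_target := isOpen_univ
  contMDiffOn_toFun := (contDiff_translate Φ a a').contMDiff.contMDiffOn
  contMDiffOn_invFun := (contDiff_translate Φ.symm a' a).contMDiff.contMDiffOn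

theorem map_leftField {Φ : Alg m r ≃ₗᵢ[ℝ] Alg m' r'}
    (hΦ : ∀ a b, Φ (bracket j a b) = bracket j' (Φ a) (Φ b)) (a b : Alg m r) :
    Φ (leftField j a b) = leftField j' (Φ a) (Φ b) := by
  simp only [leftField_apply, map_add, map_smul, hΦ]

theorem mfderiv_comp_isometry {E E' : Type*} [NormedAddCommGroup E] [NormedSpace ℝ E]
    [NormedAddCommGroup E'] [NormedSpace ℝ E'] {f : E' → E'} {g : E → E} (L : E ≃ₗᵢ[ℝ] E') {x : E}
    (hf : DifferentiableAt ℝ f (L (g x))) (hg : DifferentiableAt ℝ g x) (v : E) :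
    (mfderiv 𝓘(ℝ, E) 𝓘(ℝ, E') (fun x => f (L (g x))) x : E →L[ℝ] E') v =
      (mfderiv 𝓘(ℝ, E') 𝓘(ℝ, E') f (L (g x)) : E' →L[ℝ] E')
        (L ((mfderiv 𝓘(ℝ, E) 𝓘(ℝ, E) g x : E →L[ℝ] E) v)) := by
  have h : HasFDerivAt L (L : E →L[ℝ] E') (g x) := (L : E →L[ℝ] E').hasFDerivAt
  have h' : fderiv ℝ (fun x => f (L (g x))) x = _ :=
    (hf.hasFDerivAt.comp x (h.comp x hg.hasFDerivAt)).fderiv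
  rw [mfderiv_eq_fderiv, mfderiv_eq_fderiv, mfderiv_eq_fderiv, h']
  rfl

/-- Left translations preserve left invariant fields, and the linear map Φ, being a Lie algebra
isomorphism, is also the group homomorphism in exponential coordinates; it sends the field of A to
that of Φ A. -/
theorem mfderiv_translate {Φ : Alg m r ≃ₗᵢ[ℝ] Alg m' r'}
    (hΦ : ∀ a b, Φ (bracket j a b) = bracket j' (Φ a) (Φ b)) (a : Alg m r) (a' : Alg m' r')
    (x A : Alg m r) :
    (mfderiv 𝓘(ℝ, Alg m r) 𝓘(ℝ, Alg m' r') (translate j j' Φ a a') x : Alg m r →L[ℝ] Alg m' r')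
      (leftField j x A) = leftField j' (translate j j' Φ a a' x) (Φ A) := by
  refine (mfderiv_comp_isometry Φ ((contDiff_mulGrp j' a').differentiable (by simp) _)
    ((contDiff_mulGrp j (-a)).differentiable (by simp) x) (leftField j x A)).trans ?_
  rw [mfderiv_mulGrp, mfderiv_mulGrp, ← leftField_mulGrp, map_leftField hΦ, ← leftField_mulGrp]
  rfl

variable
  {n : ℕ} {N : Type*} [TopologicalSpace N] [ChartedSpace (Vec n) N]
  [RiemannianBundle (fun x : N => TangentSpace (𝓡 n) x)]
  {n' : ℕ} {N' : Type*} [TopologicalSpace N'] [ChartedSpace (Vec n') N']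
  [RiemannianBundle (fun x : N' => TangentSpace (𝓡 n') x)]

theorem locallyIsometric_of_bracket_isometry
    (hN : IsNilmanifold j n N) (hN' : IsNilmanifold j' n' N')
    {Φ : Alg m r ≃ₗᵢ[ℝ] Alg m' r'} (hΦ : ∀ a b, Φ (bracket j a b) = bracket j' (Φ a) (Φ b)) :
    LocallyIsometric n n' N N' := by
  obtain ⟨pr, hs, h⟩ := hN.exists_localIsometry
  obtain ⟨pr', hs', h'⟩ := hN'.exists_localIsometry
  intro p p'
  obtain ⟨a, rfl⟩ := hs p
  obtain ⟨a', rfl⟩ := hs' p'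
  set Ψ := (h.isLocalDiffeomorph a).localInverse with hΨ
  set Ψ' := (h'.isLocalDiffeomorph a').localInverse with hΨ'
  set τ := translateDiffeo j j' Φ a a' with hτ
  have e1 : Ψ (pr a) = a :=
    (h.isLocalDiffeomorph a).localInverse_left_inv (h.isLocalDiffeomorph a).localInverse_mem_target
  have e2 : Ψ' (pr' a') = a' :=
    (h'.isLocalDiffeomorph a').localInverse_left_inv
      (h'.isLocalDiffeomorph a').localInverse_mem_target
  have e3 : τ a = a' := by
    change mulGrp j' a' (Φ (mulGrp j (-a) a)) = a'
    rw [neg_mulGrp, map_zero, mulGrp_zero]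
  -- Lift by Ψ to G(j), apply x ↦ a'Φ(a⁻¹x), which takes a to a', and project down to N' by the
  -- inverse of Ψ'.
  set F := (Ψ.trans τ).trans Ψ'.symm with hF
  have hFs : ∀ q, q ∈ F.source ↔ q ∈ Ψ.source ∧ τ (Ψ q) ∈ Ψ'.target := by
    intro q
    change (q ∈ Ψ.source ∧ Ψ q ∈ Set.univ) ∧ τ (Ψ q) ∈ Ψ'.target ↔ _
    simp
  refine ⟨F, ?_, ?_, ?_⟩
  · rw [hFs, e1, e3]
    exact ⟨(h.isLocalDiffeomorph a).localInverse_mem_source,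
      (h'.isLocalDiffeomorph a').localInverse_mem_target⟩
  · change Ψ'.symm (τ (Ψ (pr a))) = pr' a'
    have e4 : τ (Ψ (pr a)) = Ψ' (pr' a') := by rw [e1, e2, e3]
    rw [e4]
    exact Ψ'.toPartialEquiv.left_inv (h'.isLocalDiffeomorph a').localInverse_mem_source
  · intro q hq u v
    have hq1 := ((hFs q).1 hq).1
    have hFq : F q ∈ Ψ'.source := Ψ'.toPartialEquiv.map_target ((hFs q).1 hq).2
    -- If w has left invariant coordinates A, then dF(w) has coordinates Φ A: differentiate Ψ' ∘ F =
    -- τ ∘ Ψ near q.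
    have hd : ∀ (w : TangentSpace (𝓡 n) q) (A : Alg m r),
        leftField j (Ψ q) A = mfderiv (𝓡 n) 𝓘(ℝ, Alg m r) Ψ q w →
        leftField j' (Ψ' (F q)) (Φ A) =
          mfderiv (𝓡 n') 𝓘(ℝ, Alg m' r') Ψ' (F q) (mfderiv (𝓡 n) (𝓡 n') F q w) := by
      intro w A hA
      have hev : Ψ' ∘ F =ᶠ[nhds q] translate j j' Φ a a' ∘ Ψ := by
        filter_upwards [F.open_source.mem_nhds hq] with z hz
        exact Ψ'.toPartialEquiv.right_inv ((hFs z).1 hz).2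
      have k1 := mfderiv_comp q (Ψ'.mdifferentiableAt (by simp) hFq) (F.mdifferentiableAt (by simp) hq)
      have k2 := mfderiv_comp q ((contDiff_translate (j := j) (j' := j') Φ a a').contMDiff.mdifferentiableAt
        (x := Ψ q) (by simp)) (Ψ.mdifferentiableAt (by simp) hq1)
      have k3 := DFunLike.congr_fun (k1.symm.trans (hev.mfderiv_eq.trans k2)) w
      refine Eq.trans ?_ k3.symm
      have k4 := mfderiv_translate hΦ a a' (Ψ q) A
      rw [hA] at k4
      refine Eq.trans ?_ k4.symm
      exact congrArg (fun x => leftField j' x (Φ A)) hev.self_of_nhds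
    obtain ⟨A, hA⟩ : ∃ A, leftField j (Ψ q) A = mfderiv (𝓡 n) 𝓘(ℝ, Alg m r) Ψ q u :=
      ⟨_, leftField_leftField_neg j (Ψ q) _⟩
    obtain ⟨B, hB⟩ : ∃ A, leftField j (Ψ q) A = mfderiv (𝓡 n) 𝓘(ℝ, Alg m r) Ψ q v :=
      ⟨_, leftField_leftField_neg j (Ψ q) _⟩
    rw [h.inner_mfderiv_localInverse a hq1 u v A B hA hB,
      h'.inner_mfderiv_localInverse a' hFq _ _ (Φ A) (Φ B) (hd u A hA) (hd v B hB)]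
    exact Φ.inner_map_map A B

end Isometries

/-! ### Passage from curvature of the manifolds to the Lie algebras -/

section Comparison

open Bundle Filter

variable {m r m' r' : ℕ} {j : Vec r →ₗ[ℝ] So m} {j' : Vec r' →ₗ[ℝ] So m'}
  {n : ℕ} {N : Type*} [TopologicalSpace N] [ChartedSpace (Vec n) N] [IsManifold (𝓡 n) ∞ N]
  [RiemannianBundle (fun x : N => TangentSpace (𝓡 n) x)]
  [IsContMDiffRiemannianBundle (𝓡 n) ∞ (Vec n) (fun x : N => TangentSpace (𝓡 n) x)]
  {n' : ℕ} {N' : Type*} [TopologicalSpace N'] [ChartedSpace (Vec n') N'] [IsManifold (𝓡 n') ∞ N']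
  [RiemannianBundle (fun x : N' => TangentSpace (𝓡 n') x)]
  [IsContMDiffRiemannianBundle (𝓡 n') ∞ (Vec n') (fun x : N' => TangentSpace (𝓡 n') x)]

/-- The tangent spaces of a nilmanifold are isometric to the metric Lie algebra, compatibly with
the curvature tensors. -/
theorem IsNilmanifold.exists_tangent_isometry (hN : IsNilmanifold j n N) (p : N) :
    ∃ e : Alg m r ≃ₗᵢ[ℝ] TangentSpace (𝓡 n) p,
      ∀ D : CovariantDerivative (𝓡 n) (Vec n) (fun x : N => TangentSpace (𝓡 n) x),
        IsLeviCivita D → ∀ A B C, curvature D p (e A) (e B) (e C) = e (curvatureAlg j A B C) := by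
  obtain ⟨pr, hs, h⟩ := hN.exists_localIsometry
  obtain ⟨a, rfl⟩ := hs p
  obtain ⟨E, U, hE, hU⟩ := h.exists_frame a
  refine ⟨LinearIsometryEquiv.ofSurjective ⟨E (pr a), fun A => ?_⟩ (hE.surj _ hU),
    fun D hD A B C => hE.curvature_apply hD hU A B C⟩
  have := hE.inner_eq _ hU A A
  rw [real_inner_self_eq_norm_sq, real_inner_self_eq_norm_sq] at this
  exact (sq_eq_sq₀ (norm_nonneg _) (norm_nonneg _)).1 this

theorem exists_curvatureAlg_isometry (hN : IsNilmanifold j n N) (hN' : IsNilmanifold j' n' N')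
    (h : CurvatureEquivalent n n' N N') :
    ∃ F : Alg m r ≃ₗᵢ[ℝ] Alg m' r', ∀ A B C : Alg m r,
      F (curvatureAlg j A B C) = curvatureAlg j' (F A) (F B) (F C) := by
  obtain ⟨p, p', D, D', hD, hD', F, hF⟩ := h
  obtain ⟨e, he⟩ := hN.exists_tangent_isometry p
  obtain ⟨e', he'⟩ := hN'.exists_tangent_isometry p'
  refine ⟨(e.trans F).trans e'.symm, fun A B C => ?_⟩
  apply e'.injective
  rw [← he' D' hD']
  simp only [LinearIsometryEquiv.trans_apply, LinearIsometryEquiv.apply_symm_apply]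
  rw [← hF, he D hD]

end Comparison

end HeisenbergNil

end

open HeisenbergNil Bundle in
theorem mainTheorem4 {m r m' r' n n' : ℕ}
    (j : Vec r →ₗ[ℝ] So m) (j' : Vec r' →ₗ[ℝ] So m')
    (hj : IsHeisenbergType j) (hj' : IsHeisenbergType j')
    (N : Type*) [TopologicalSpace N] [T2Space N] [ChartedSpace (Vec n) N]
    [IsManifold (𝓡 n) ∞ N]
    [RiemannianBundle (fun x : N => TangentSpace (𝓡 n) x)]
    [IsContMDiffRiemannianBundle (𝓡 n) ∞ (Vec n) (fun x : N => TangentSpace (𝓡 n) x)]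
    (N' : Type*) [TopologicalSpace N'] [T2Space N'] [ChartedSpace (Vec n') N']
    [IsManifold (𝓡 n') ∞ N']
    [RiemannianBundle (fun x : N' => TangentSpace (𝓡 n') x)]
    [IsContMDiffRiemannianBundle (𝓡 n') ∞ (Vec n') (fun x : N' => TangentSpace (𝓡 n') x)]
    (hN : IsNilmanifold j n N) (hN' : IsNilmanifold j' n' N')
    (hNN' : ¬ LocallyIsometric n n' N N') :
    ¬ CurvatureEquivalent n n' N N' ∧
      ¬ ∃ F : Alg m r ≃ₗᵢ[ℝ] Alg m' r', ∀ A B C : Alg m r,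
        F (curvatureAlg j A B C) = curvatureAlg j' (F A) (F B) (F C) := by
  have key : ¬ ∃ F : Alg m r ≃ₗᵢ[ℝ] Alg m' r', PreservesCurvature j j' F := by
    rintro ⟨F, hF⟩
    obtain ⟨Φ, hΦ⟩ := hF.exists_bracket_isometry hj hj'
    exact hNN' (locallyIsometric_of_bracket_isometry hN hN' hΦ)
  exact ⟨fun h => key (exists_curvatureAlg_isometry hN hN' h), key⟩
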